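/- Consider a $T$-round linear stochastic bandit in $\mathbb{R}^d$ ($d,T\ge 1$) with unknown parameter $\mathbf w^*$: in round $t$ the learner gets a decision set $\mathcal D_t\subseteq\mathbb R^d$, picks $\mathbf x_t\in\mathcal D_t$ on the basis of the past and of $\mathcal D_t$, and observes $y_t=\mathbf x_t^\top\mathbf w^*+\eta_t$, where $\eta_t$ is conditionally $R$-sub-Gaussian given the information available when $\mathbf x_t$ is chosen. Assume that $\|\mathbf x\|_2\le L$ and $\mathbf x^\top\mathbf w^*\in[-1,1]$ for all $\mathbf x\in\mathcal D_t$ and all $t$, and that $\mathbf x_t^*\in\arg\max_{\mathbf x\in\mathcal D_t}\mathbf x^\top\mathbf w^*$ exists. The pseudo-regret is $R(T,\mathbf w^*)=\sum_{t=1}^T(\mathbf x_t^*-\mathbf x_t)^\top\mathbf w^*$, and $\overline R(T,\mathbf w^*)$ is its expectation. For $\mathbf h\in\mathbb R^d$ and $\lambda\ge 1$ put $\mathbf V_t=\lambda\mathbf I+\sum_{s\le t}\mathbf x_s\mathbf x_s^\top$, $\widehat{\mathbf w}_t^{\mathbf h}=\mathbf V_t^{-1}\sum_{s\le t}(y_s-\mathbf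 x_s^\top\mathbf h)\,\mathbf x_s+\mathbf h$ and $$\beta_t^{\mathbf h}=\lambda^{1/2}\|\mathbf h-\mathbf w^*\|_2+R\sqrt{2\log\frac{\det(\mathbf V_t)^{1/2}}{\det(\lambda\mathbf I)^{1/2}\,\delta}},\qquad \delta=\tfrac1T .$$ BIAS-OFUL with bias $\mathbf h$ picks, in each round $t$, some $\mathbf x_t\in\arg\max_{\mathbf x\in\mathcal D_t}\{\mathbf x^\top\widehat{\mathbf w}_{t-1}^{\mathbf h}+\beta_{t-1}^{\mathbf h}\|\mathbf x\|_{\mathbf V_{t-1}^{-1}}\}$, where $\|\mathbf x\|_{A}=\sqrt{\mathbf x^\top A\mathbf x}$. There is an absolute constant $C_0>0$ such that, with $C=C_0\max(1,L^2)$, the following holds. (i) (Independent task learning.) If $\mathbf h=\mathbf 0$ and $\|\mathbf w^*\|_2\le S$, then $$\overline R(T,\mathbf w^*)\le C\sqrt{Td\log\Big(1+\frac{TL}{\lambda d}\Big)}\;\Big(\lambda^{1/2}S+R\sqrt{d\log\big(T+T^2L/(\lambda d)\big)}\Big).$$ For all fixed $\lambda\ge 1$ and $L,S,R\ge 0$,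 the right-hand side is $O(d\sqrt T)$ up to a logarithmic factor in $T$: there is $K$, depending only on $\lambda,L,S,R$, such that it is at most $K\,d\sqrt T\,\log(1+T)$ for all $d,T\ge 1$. (ii) (Oracle.) If $\mathbf h=\mathbf w^*$, then $$\overline R(T,\mathbf w^*)\le C\sqrt{Td\log\Big(1+\frac{TL}{\lambda d}\Big)}\;R\sqrt{d\log\big(T+T^2L/(\lambda d)\big)},$$ and for fixed $d,T,L,R$ the right-hand side tends to $0$ as $\lambda\to\infty$. -/

import Mathlib

open MeasureTheory ProbabilityTheory Filter Topology Matrix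

noncomputable section

namespace BiasOFUL

/-- Arms and parameters live in `ℝ^d` with the Euclidean norm. -/
abbrev Vec (d : ℕ) : Type := EuclideanSpace ℝ (Fin d)

/-- The norm `‖z‖_A = √(zᵀ A z)` weighted by a matrix `A`. -/
def weightedNorm {d : ℕ} (A : Matrix (Fin d) (Fin d) ℝ) (z : Vec d) : ℝ :=
  Real.sqrt (z.ofLp ⬝ᵥ (A *ᵥ z.ofLp))

/-- `V_t = lam I + ∑_{s < t} x_s x_sᵀ`, the regularized design matrix after `t` rounds.
Rounds are numbered `0, 1, 2, …`. -/
def designMatrix {d : ℕ} (lam : ℝ) (x : ℕ → Vec d) (t : ℕ) : Matrix (Fin d) (Fin d) ℝ :=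
  lam • (1 : Matrix (Fin d) (Fin d) ℝ)
    + ∑ s ∈ Finset.range t, Matrix.vecMulVec (x s).ofLp (x s).ofLp

/-- The biased ridge regression estimate after `t` rounds,
`V_t⁻¹ Xᵀ (Y - X h) + h = V_t⁻¹ ∑_{s < t} (y_s - ⟨x_s, h⟩) x_s + h`. -/
def biasedEstimate {d : ℕ} (lam : ℝ) (h : Vec d) (x : ℕ → Vec d) (y : ℕ → ℝ) (t : ℕ) : Vec d :=
  WithLp.toLp 2 ((designMatrix lam x t)⁻¹ *ᵥ
    (∑ s ∈ Finset.range t, (y s - inner ℝ (x s) h) • (x s).ofLp)) + h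

/-- The radius of the confidence ellipsoid after `t` rounds,
`lam^{1/2} ‖h - w‖ + R √(2 log (det(V_t)^{1/2} / (det(lam I)^{1/2} δ)))`. -/
def confidenceRadius {d : ℕ} (lam R δ : ℝ) (h w : Vec d) (x : ℕ → Vec d) (t : ℕ) : ℝ :=
  Real.sqrt lam * ‖h - w‖
    + R * Real.sqrt (2 * Real.log (Real.sqrt (designMatrix lam x t).det
        / (Real.sqrt (lam • (1 : Matrix (Fin d) (Fin d) ℝ)).det * δ)))

/-- The optimistic value of an arm `z` after `t` rounds,
`⟨z, ŵ_t⟩ + β_t(δ) ‖z‖_{V_t⁻¹}`, for the true parameter `w` and the bias `h`. -/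
def optimisticIndex {d : ℕ} (lam R δ : ℝ) (h w : Vec d) (x : ℕ → Vec d) (y : ℕ → ℝ) (t : ℕ)
    (z : Vec d) : ℝ :=
  inner ℝ z (biasedEstimate lam h x y t)
    + confidenceRadius lam R δ h w x t * weightedNorm (designMatrix lam x t)⁻¹ z

/-- The observed reward `y_t = ⟨x_t, w⟩ + η_t`. -/
def reward {d : ℕ} {Ω : Type*} (w : Vec d) (η : ℕ → Ω → ℝ) (x : ℕ → Ω → Vec d) (t : ℕ) (ω : Ω) :
    ℝ :=
  inner ℝ (x t ω) w + η t ω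

/-- A `T`-round linear stochastic bandit with parameter `w`. The σ-algebra `ℱ t` is the information
that is available when the arm of round `t` is chosen (it includes the decision set of that round).
The noise `η t` of round `t` is revealed afterwards and is conditionally `R`-sub-Gaussian
given `ℱ t`. The decision sets may be random; a fixed sequence of sets is a special case.
`xstar t` is the arm chosen by the optimal policy. -/
structure IsLinearBandit {d : ℕ} {Ω : Type*} {mΩ : MeasurableSpace Ω} (μ : Measure Ω)
    (ℱ : Filtration ℕ mΩ) (T : ℕ) (L R : ℝ) (w : Vec d) (𝒟 : ℕ → Ω → Set (Vec d))
    (η : ℕ → Ω → ℝ) (xstar : ℕ → Ω → Vec d) : Prop where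
  noise_measurable : ∀ t < T, Measurable[ℱ (t + 1)] (η t)
  noise_integrable_exp : ∀ t < T, ∀ s : ℝ, Integrable (fun ω => Real.exp (s * η t ω)) μ
  noise_subgaussian : ∀ t < T, ∀ s : ℝ,
    μ[fun ω => Real.exp (s * η t ω) | ℱ t] ≤ᵐ[μ] fun _ => Real.exp (s ^ 2 * R ^ 2 / 2)
  norm_le : ∀ t < T, ∀ ω, ∀ z ∈ 𝒟 t ω, ‖z‖ ≤ L
  payoff_mem : ∀ t < T, ∀ ω, ∀ z ∈ 𝒟 t ω, inner ℝ z w ∈ Set.Icc (-1 : ℝ) 1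
  optimal_measurable : ∀ t < T, Measurable (xstar t)
  optimal_mem : ∀ t < T, ∀ ω, xstar t ω ∈ 𝒟 t ω
  optimal : ∀ t < T, ∀ ω, ∀ z ∈ 𝒟 t ω, inner ℝ z w ≤ (inner ℝ (xstar t ω) w : ℝ)

/-- `x` is the sequence of arms pulled by BIAS-OFUL with bias `h`, regularization `lam` and
confidence level `δ`: the arm of each round is chosen from the past, lies in the decision set, and
maximizes there the optimistic value computed from the arms and rewards of the previous rounds.
Ties are broken arbitrarily. -/
structure IsBiasOFULRun {d : ℕ} {Ω : Type*} {mΩ : MeasurableSpace Ω}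
    (ℱ : Filtration ℕ mΩ) (T : ℕ) (lam R δ : ℝ) (h w : Vec d) (𝒟 : ℕ → Ω → Set (Vec d))
    (η : ℕ → Ω → ℝ) (x : ℕ → Ω → Vec d) : Prop where
  predictable : ∀ t < T, Measurable[ℱ t] (x t)
  arm_mem : ∀ t < T, ∀ ω, x t ω ∈ 𝒟 t ω
  arm_argmax : ∀ t < T, ∀ ω, ∀ z ∈ 𝒟 t ω,
    optimisticIndex lam R δ h w (fun s => x s ω) (fun s => reward w η x s ω) t z
      ≤ optimisticIndex lam R δ h w (fun s => x s ω) (fun s => reward w η x s ω) t (x t ω)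

/-- The pseudo-regret `∑_{t < T} ⟨xstar_t - x_t, w⟩`. -/
def pseudoRegret {d : ℕ} {Ω : Type*} (T : ℕ) (w : Vec d) (xstar x : ℕ → Ω → Vec d) (ω : Ω) : ℝ :=
  ∑ t ∈ Finset.range T, inner ℝ (xstar t ω - x t ω) w

/-- The regret bound for the bias `h = 0`. -/
def itlBound (C : ℝ) (d T : ℕ) (lam L S R : ℝ) : ℝ :=
  C * Real.sqrt (T * d * Real.log (1 + T * L / (lam * d)))
    * (Real.sqrt lam * S + R * Real.sqrt (d * Real.log (T + T ^ 2 * L / (lam * d))))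

/-- The regret bound for the bias `h = w`. -/
def oracleBound (C : ℝ) (d T : ℕ) (lam L R : ℝ) : ℝ :=
  C * Real.sqrt (T * d * Real.log (1 + T * L / (lam * d)))
    * (R * Real.sqrt (d * Real.log (T + T ^ 2 * L / (lam * d))))

end BiasOFUL

end

/-! In direction `z` the biased ridge estimate errs by at most ‖z‖_{V⁻¹} times the sum of √λ‖h − w‖
and the self-normalized noise ‖∑ η_s x_s‖_{V⁻¹}. Where the radius β dominates this sum, optimism
bounds the regret of a round by 2β‖x_t‖_{V⁻¹}. The widths ‖x_t‖_{V⁻¹} are summed by Cauchy–Schwarz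
and the elliptical potential lemma: log det V_t grows by log(1 + ‖x_t‖²_{V⁻¹}) per round and is
capped through the trace.

The noise is controlled in expectation, without a maximal inequality or a good event. The process
M_t = `selfNorm` has expectation at most 1, because its one-step factor is a mixture over s of
exp(sη − s²R²/2), with Gaussian weights known before the noise is revealed
(`lintegral_mixture_step`). Since log q ≤ q², the noise exceeds its radius by at most (√2 R / T) M_t
on every path (`sqrt_noiseForm_le`). There is no excess in the first round, so the total expected
excess is at most √2 R (T − 1)/T.

The excess enters the regret with the factor 2L/√λ. It cannot be left as an additive term of
constant order, because the oracle bound tends to 0 as λ → ∞. Instead `div_sqrt_le` and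
`sub_one_div_le_sqrt_log` absorb L/√λ and (T − 1)/T into the two factors of the bound. The result,
`integral_pseudoRegret_le`, holds for every bias with ‖h − w‖ in the role of S; the biases 0 and w
are special cases. -/

namespace BiasOFUL

/-! ### Rank-one updates and determinants of positive definite matrices. -/

section LinearAlgebra

variable {n : Type*} [Fintype n] [DecidableEq n]

theorem dotProduct_mulVec_symm {n : Type*} [Fintype n] {A : Matrix n n ℝ}
    (hA : A.IsHermitian) (y z : n → ℝ) : y ⬝ᵥ (A *ᵥ z) = z ⬝ᵥ (A *ᵥ y) := by
  rw [dotProduct_comm, ← vecMul_transpose, ← dotProduct_mulVec,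
    ← conjTranspose_eq_transpose_of_trivial, hA.eq]

/-- Cauchy–Schwarz for the bilinear form of a positive semidefinite matrix. -/
theorem sq_dotProduct_mulVec_le {A : Matrix n n ℝ} (hA : A.PosSemidef) (y z : n → ℝ) :
    (y ⬝ᵥ (A *ᵥ z)) ^ 2 ≤ (y ⬝ᵥ (A *ᵥ y)) * (z ⬝ᵥ (A *ᵥ z)) := by
  have key := LinearMap.BilinForm.apply_sq_le_of_symm (Matrix.toBilin' A)
    (fun x => by
      rw [Matrix.toBilin'_apply']
      simpa using hA.dotProduct_mulVec_nonneg x)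
    (by
      constructor
      intro x y
      simp only [Matrix.toBilin'_apply', RingHom.id_apply]
      exact dotProduct_mulVec_symm hA.isHermitian x y) y z
  simpa only [Matrix.toBilin'_apply'] using key

/-- The Sherman–Morrison formula for a symmetric update, applied to a vector. -/
theorem inv_add_vecMulVec_mulVec {A : Matrix n n ℝ} (hA : A.PosDef) (x z : n → ℝ) :
    (A + vecMulVec x x)⁻¹ *ᵥ z
      = A⁻¹ *ᵥ z - ((x ⬝ᵥ (A⁻¹ *ᵥ z)) / (1 + x ⬝ᵥ (A⁻¹ *ᵥ x))) • (A⁻¹ *ᵥ x) := by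
  have hpos : (A + vecMulVec x x).PosDef :=
    hA.add_posSemidef (by simpa using posSemidef_vecMulVec_self_star x)
  have hu : 0 ≤ x ⬝ᵥ (A⁻¹ *ᵥ x) := by simpa using hA.inv.posSemidef.dotProduct_mulVec_nonneg x
  have hdet : IsUnit (A + vecMulVec x x).det := hpos.det_pos.ne'.isUnit
  have hdetA : IsUnit A.det := hA.det_pos.ne'.isUnit
  -- The claimed value is verified by applying A + xxᵀ to it.
  set r := A⁻¹ *ᵥ z - ((x ⬝ᵥ (A⁻¹ *ᵥ z)) / (1 + x ⬝ᵥ (A⁻¹ *ᵥ x))) • (A⁻¹ *ᵥ x) with hr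
  have hz : (A + vecMulVec x x) *ᵥ r = z := by
    have h1 : ∀ v, A *ᵥ (A⁻¹ *ᵥ v) = v := fun v => by
      rw [mulVec_mulVec, mul_nonsing_inv _ hdetA, one_mulVec]
    rw [add_mulVec, vecMulVec_mulVec, hr, mulVec_sub, mulVec_smul, h1, h1, dotProduct_sub,
      dotProduct_smul]
    ext i
    simp only [Pi.add_apply, Pi.sub_apply, Pi.smul_apply, smul_eq_mul, MulOpposite.smul_eq_mul_unop,
      MulOpposite.unop_op]
    field_simp
    ring
  rw [← hz, mulVec_mulVec, nonsing_inv_mul _ hdet, one_mulVec]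

theorem det_add_vecMulVec_self {A : Matrix n n ℝ} (hA : A.PosDef) (x : n → ℝ) :
    (A + vecMulVec x x).det = A.det * (1 + x ⬝ᵥ (A⁻¹ *ᵥ x)) := by
  have h := det_add_replicateCol_mul_replicateRow (ι := Unit) hA.det_pos.ne'.isUnit x x
  rw [vecMulVec_eq Unit]
  rw [h]
  congr 2
  simp [Matrix.det_unique, Matrix.mul_apply, dotProduct, mulVec, replicateRow, replicateCol, Finset.sum_mul,
    Finset.mul_sum]
  rw [Finset.sum_comm]
  refine Finset.sum_congr rfl fun i _ => Finset.sum_congr rfl fun j _ => by ring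

/-- The effect of a rank-one update on the inverse quadratic form. -/
theorem quadForm_rank_one_update {A : Matrix n n ℝ} (hA : A.PosDef) (x z : n → ℝ) (e : ℝ) :
    (z + e • x) ⬝ᵥ ((A + vecMulVec x x)⁻¹ *ᵥ (z + e • x))
      = z ⬝ᵥ (A⁻¹ *ᵥ z)
        + ((x ⬝ᵥ (A⁻¹ *ᵥ x)) * e ^ 2 + 2 * (x ⬝ᵥ (A⁻¹ *ᵥ z)) * e - (x ⬝ᵥ (A⁻¹ *ᵥ z)) ^ 2)
          / (1 + x ⬝ᵥ (A⁻¹ *ᵥ x)) := by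
  have hu : 0 ≤ x ⬝ᵥ (A⁻¹ *ᵥ x) := by simpa using hA.inv.posSemidef.dotProduct_mulVec_nonneg x
  rw [inv_add_vecMulVec_mulVec hA]
  simp only [mulVec_add, mulVec_smul, dotProduct_add, add_dotProduct, dotProduct_sub,
    dotProduct_smul, smul_dotProduct, smul_eq_mul]
  rw [dotProduct_mulVec_symm hA.inv.isHermitian z x]
  field_simp
  ring

/-- The determinant of a positive definite matrix is bounded through its trace. -/
theorem log_det_le_card_mul_log_trace [Nonempty n] {A : Matrix n n ℝ} (hA : A.PosDef) :
    Real.log A.det ≤ Fintype.card n * Real.log (A.trace / Fintype.card n) := by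
  have hH := hA.isHermitian
  have hc : (0 : ℝ) < Fintype.card n := by exact_mod_cast Fintype.card_pos
  have hdet : A.det = ∏ i, hH.eigenvalues i := by simpa using hH.det_eq_prod_eigenvalues
  have htr : A.trace = ∑ i, hH.eigenvalues i := by simpa using hH.trace_eq_sum_eigenvalues
  rw [hdet, htr, Real.log_prod (fun i _ => (hA.eigenvalues_pos i).ne')]
  -- AM–GM for the eigenvalues, as Jensen's inequality for log with uniform weights.
  have := strictConcaveOn_log_Ioi.concaveOn.le_map_sum (t := Finset.univ)
    (w := fun _ : n => (Fintype.card n : ℝ)⁻¹) (p := hH.eigenvalues)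
    (fun _ _ => by positivity) (by simp) (fun i _ => hA.eigenvalues_pos i)
  simp only [smul_eq_mul, ← Finset.mul_sum] at this
  rw [inv_mul_le_iff₀ hc] at this
  rwa [div_eq_inv_mul]

end LinearAlgebra

/-! ### The design matrix and the elliptical potential. -/

section Design

variable {d : ℕ}

theorem designMatrix_posDef {lam : ℝ} (hlam : 0 < lam) (x : ℕ → Vec d) (t : ℕ) :
    (designMatrix lam x t).PosDef := by
  refine (PosDef.one.smul hlam).add_posSemidef ?_
  refine posSemidef_sum _ fun s _ => ?_
  simpa using posSemidef_vecMulVec_self_star (x s).ofLp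

theorem designMatrix_succ (lam : ℝ) (x : ℕ → Vec d) (t : ℕ) :
    designMatrix lam x (t + 1) = designMatrix lam x t + vecMulVec (x t).ofLp (x t).ofLp := by
  simp [designMatrix, Finset.sum_range_succ, add_assoc]

theorem det_designMatrix_zero (lam : ℝ) (x : ℕ → Vec d) :
    (designMatrix lam x 0).det = lam ^ d := by
  simp [designMatrix]

/-- The elliptical potential of an arm, `‖x_t‖²_{V_t⁻¹}`. -/
noncomputable def potential (lam : ℝ) (x : ℕ → Vec d) (t : ℕ) : ℝ :=
  (x t).ofLp ⬝ᵥ ((designMatrix lam x t)⁻¹ *ᵥ (x t).ofLp)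

theorem quadForm_inv_nonneg {lam : ℝ} (hlam : 0 < lam) (x : ℕ → Vec d) (t : ℕ) (z : Fin d → ℝ) :
    0 ≤ z ⬝ᵥ ((designMatrix lam x t)⁻¹ *ᵥ z) := by
  simpa using (designMatrix_posDef hlam x t).inv.posSemidef.dotProduct_mulVec_nonneg z

theorem potential_nonneg {lam : ℝ} (hlam : 0 < lam) (x : ℕ → Vec d) (t : ℕ) :
    0 ≤ potential lam x t := quadForm_inv_nonneg hlam x t _

theorem dotProduct_self_eq_norm_sq (z : Vec d) : z.ofLp ⬝ᵥ z.ofLp = ‖z‖ ^ 2 := by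
  rw [EuclideanSpace.real_norm_sq_eq]
  simp [dotProduct, sq]

theorem lam_mul_le_quadForm {lam : ℝ} (x : ℕ → Vec d) (t : ℕ) (z : Fin d → ℝ) :
    lam * (z ⬝ᵥ z) ≤ z ⬝ᵥ (designMatrix lam x t *ᵥ z) := by
  have hS : (∑ s ∈ Finset.range t, vecMulVec (x s).ofLp (x s).ofLp).PosSemidef :=
    posSemidef_sum _ fun s _ => by simpa using posSemidef_vecMulVec_self_star (x s).ofLp
  have h := hS.dotProduct_mulVec_nonneg z
  simp only [star_trivial] at h
  rw [designMatrix, add_mulVec, dotProduct_add, smul_mulVec, one_mulVec, dotProduct_smul,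
    smul_eq_mul]
  linarith

theorem mulVec_inv_mulVec {lam : ℝ} (hlam : 0 < lam) (x : ℕ → Vec d) (t : ℕ) (z : Fin d → ℝ) :
    designMatrix lam x t *ᵥ ((designMatrix lam x t)⁻¹ *ᵥ z) = z := by
  rw [mulVec_mulVec, mul_nonsing_inv _ (designMatrix_posDef hlam x t).det_pos.ne'.isUnit,
    one_mulVec]

theorem inv_mulVec_mulVec {lam : ℝ} (hlam : 0 < lam) (x : ℕ → Vec d) (t : ℕ) (z : Fin d → ℝ) :
    (designMatrix lam x t)⁻¹ *ᵥ (designMatrix lam x t *ᵥ z) = z := by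
  rw [mulVec_mulVec, nonsing_inv_mul _ (designMatrix_posDef hlam x t).det_pos.ne'.isUnit,
    one_mulVec]

/-- With y = V⁻¹z, V ≥ λI gives λ|y|² ≤ z·y, and expanding |z − λy|² ≥ 0 turns this into λ z·y ≤
|z|². -/
theorem quadForm_inv_le {lam : ℝ} (hlam : 0 < lam) (x : ℕ → Vec d) (t : ℕ) (z : Fin d → ℝ) :
    z ⬝ᵥ ((designMatrix lam x t)⁻¹ *ᵥ z) ≤ (z ⬝ᵥ z) / lam := by
  set y := (designMatrix lam x t)⁻¹ *ᵥ z with hy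
  have h1 : lam * (y ⬝ᵥ y) ≤ z ⬝ᵥ y := by
    have := lam_mul_le_quadForm (lam := lam) x t y
    rwa [hy, mulVec_inv_mulVec hlam, ← hy, dotProduct_comm y z] at this
  have h2 : 0 ≤ (z - lam • y) ⬝ᵥ (z - lam • y) := by
    simpa using dotProduct_star_self_nonneg (z - lam • y)
  simp only [sub_dotProduct, dotProduct_sub, smul_dotProduct, dotProduct_smul, smul_eq_mul] at h2
  rw [dotProduct_comm y z] at h2
  rw [le_div_iff₀ hlam]
  nlinarith

theorem weightedNorm_inv_le {lam : ℝ} (hlam : 0 < lam) (x : ℕ → Vec d) (t : ℕ) (z : Vec d) :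
    weightedNorm (designMatrix lam x t)⁻¹ z ≤ ‖z‖ / Real.sqrt lam := by
  rw [weightedNorm]
  refine Real.sqrt_le_iff.2 ⟨by positivity, ?_⟩
  rw [div_pow, Real.sq_sqrt hlam.le, ← dotProduct_self_eq_norm_sq]
  exact quadForm_inv_le hlam x t _

/-- Each round multiplies the determinant by 1 + potential, by the matrix determinant lemma. This
ties the confidence radius and the sum of the widths to the same quantity. -/
theorem log_det_designMatrix {lam : ℝ} (hlam : 0 < lam) (x : ℕ → Vec d) (t : ℕ) :
    Real.log (designMatrix lam x t).det
      = Real.log (lam ^ d) + ∑ s ∈ Finset.range t, Real.log (1 + potential lam x s) := by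
  induction t with
  | zero => simp [det_designMatrix_zero]
  | succ t ih =>
    rw [designMatrix_succ, det_add_vecMulVec_self (designMatrix_posDef hlam x t),
      Real.log_mul (designMatrix_posDef hlam x t).det_pos.ne', ih, Finset.sum_range_succ, add_assoc]
    · rfl
    · have := potential_nonneg hlam x t
      rw [potential] at this
      positivity

theorem trace_designMatrix_le {lam L : ℝ} (x : ℕ → Vec d) (t : ℕ)
    (hx : ∀ s < t, ‖x s‖ ≤ L) : (designMatrix lam x t).trace ≤ lam * d + t * L ^ 2 := by
  rw [designMatrix, trace_add, trace_smul, trace_one, trace_sum]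
  simp only [trace_vecMulVec, dotProduct_self_eq_norm_sq, smul_eq_mul, Fintype.card_fin]
  have : ∑ s ∈ Finset.range t, ‖x s‖ ^ 2 ≤ ∑ s ∈ Finset.range t, L ^ 2 :=
    Finset.sum_le_sum fun s hs => pow_le_pow_left₀ (norm_nonneg _) (hx s (Finset.mem_range.1 hs)) 2
  simp at this
  linarith

/-- The elliptical potential lemma, logarithmic form. -/
theorem sum_log_potential_le {lam L : ℝ} (hd : 0 < d) (hlam : 0 < lam) (x : ℕ → Vec d) (t : ℕ)
    (hx : ∀ s < t, ‖x s‖ ≤ L) :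
    ∑ s ∈ Finset.range t, Real.log (1 + potential lam x s)
      ≤ d * Real.log (1 + t * L ^ 2 / (lam * d)) := by
  have : Nonempty (Fin d) := ⟨⟨0, hd⟩⟩
  have hd' : (0 : ℝ) < d := by exact_mod_cast hd
  have hV := designMatrix_posDef hlam x t
  have h1 := log_det_le_card_mul_log_trace hV
  have h2 := log_det_designMatrix hlam x t
  have h0 : 0 < (designMatrix lam x t).trace := hV.trace_pos
  rw [Fintype.card_fin] at h1
  have h3 : Real.log ((designMatrix lam x t).trace / d)
      ≤ Real.log (lam * (1 + t * L ^ 2 / (lam * d))) := by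
    refine Real.log_le_log (by positivity) ?_
    rw [div_le_iff₀ hd']
    refine (trace_designMatrix_le x t hx).trans (le_of_eq ?_)
    field_simp
  rw [Real.log_mul hlam.ne' (by positivity)] at h3
  rw [h2, Real.log_pow] at h1
  nlinarith

end Design

end BiasOFUL

namespace BiasOFUL

/-! ### Exponential moments of conditionally sub-Gaussian noise and their Gaussian mixtures. -/

section SubGaussian

theorem lintegral_exp_neg_mul_sub_sq {b : ℝ} (hb : 0 < b) (c : ℝ) :
    ∫⁻ s : ℝ, ENNReal.ofReal (Real.exp (-b * (s - c) ^ 2))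
      = ENNReal.ofReal (Real.sqrt (Real.pi / b)) := by
  rw [← ofReal_integral_eq_lintegral_ofReal ((integrable_exp_neg_mul_sq hb).comp_sub_right c)
    (ae_of_all _ fun _ => (Real.exp_pos _).le),
    integral_sub_right_eq_self (fun s => Real.exp (-b * s ^ 2)) c, integral_gaussian]

variable {Ω : Type*} {m mΩ : MeasurableSpace Ω} {μ : Measure Ω}

/-- The conditional moment bound may be integrated against nonnegative `m`-measurable weights. -/
theorem lintegral_mul_exp_le [IsFiniteMeasure μ] (hm : m ≤ mΩ) {η : Ω → ℝ} {s c : ℝ}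
    (hη : Measurable η) (hint : Integrable (fun ω => Real.exp (s * η ω)) μ)
    (hsub : μ[fun ω => Real.exp (s * η ω) | m] ≤ᵐ[μ] fun _ => c)
    {G : Ω → ENNReal} (hG : Measurable[m] G) :
    ∫⁻ ω, ENNReal.ofReal (Real.exp (s * η ω)) * G ω ∂μ ≤ ENNReal.ofReal c * ∫⁻ ω, G ω ∂μ := by
  have hmeas : Measurable fun ω => ENNReal.ofReal (Real.exp (s * η ω)) := by fun_prop
  -- The conditional bound says that, on `m`, the measure with density exp(sη) is dominated by c·μ;
  -- integrating `G` against both measures gives the claim.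
  have hle : (μ.withDensity fun ω => ENNReal.ofReal (Real.exp (s * η ω))).trim hm
      ≤ (ENNReal.ofReal c • μ).trim hm := by
    rw [@Measure.le_iff]
    intro A hA
    rw [trim_measurableSet_eq hm hA, trim_measurableSet_eq hm hA, withDensity_apply _ (hm _ hA),
      ← ofReal_integral_eq_lintegral_ofReal hint.integrableOn
        (ae_of_all _ fun _ => (Real.exp_pos _).le), ← setIntegral_condExp hm hint hA]
    have h1 := setIntegral_mono_ae (s := A) (integrable_condExp.integrableOn)
      (integrable_const c).integrableOn hsub
    rw [setIntegral_const, smul_eq_mul, mul_comm] at h1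
    refine (ENNReal.ofReal_le_ofReal h1).trans ?_
    rw [ENNReal.ofReal_mul' measureReal_nonneg, Measure.smul_apply, smul_eq_mul, ofReal_measureReal]
  have h := lintegral_mono' hle (le_refl G)
  rw [lintegral_trim hm hG, lintegral_trim hm hG, lintegral_smul_measure,
    lintegral_withDensity_eq_lintegral_mul _ hmeas (hG.mono hm le_rfl)] at h
  simpa using h

/-- The density of the Gaussian law with mean `a / R²` and variance `u / R²`
(zero if `u = 0`). -/
noncomputable def mixtureDensity (R a u s : ℝ) : ℝ :=
  Real.sqrt (R ^ 2 / (2 * Real.pi * u)) * Real.exp (-(R ^ 2 / (2 * u)) * (s - a / R ^ 2) ^ 2)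

theorem lintegral_mixtureDensity {R u : ℝ} (hR : 0 < R) (hu : 0 < u) (a : ℝ) :
    ∫⁻ s, ENNReal.ofReal (mixtureDensity R a u s) = 1 := by
  unfold mixtureDensity
  simp_rw [ENNReal.ofReal_mul (Real.sqrt_nonneg _)]
  rw [lintegral_const_mul' _ _ ENNReal.ofReal_ne_top, lintegral_exp_neg_mul_sub_sq (by positivity),
    ← ENNReal.ofReal_mul (Real.sqrt_nonneg _), ← Real.sqrt_mul (by positivity)]
  rw [show R ^ 2 / (2 * Real.pi * u) * (Real.pi / (R ^ 2 / (2 * u))) = 1 by field_simp]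
  simp

/-- Completing the square in s. The right-hand side is the factor by which `selfNorm` changes in one
round, with u = ‖x‖²_{V⁻¹}, a = xᵀV⁻¹S for the accumulated noise S, and new noise e. -/
theorem lintegral_mixtureDensity_mul_exp {R u : ℝ} (hR : 0 < R) (hu : 0 < u) (a e : ℝ) :
    ∫⁻ s, ENNReal.ofReal (mixtureDensity R a u s * Real.exp (-(s ^ 2 * R ^ 2 / 2))
        * Real.exp (s * e))
      = ENNReal.ofReal (1 / Real.sqrt (1 + u)
        * Real.exp ((u * e ^ 2 + 2 * a * e - a ^ 2) / (2 * R ^ 2 * (1 + u)))) := by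
  have hpt : ∀ s, mixtureDensity R a u s * Real.exp (-(s ^ 2 * R ^ 2 / 2)) * Real.exp (s * e)
      = (Real.sqrt (R ^ 2 / (2 * Real.pi * u))
          * Real.exp ((u * e ^ 2 + 2 * a * e - a ^ 2) / (2 * R ^ 2 * (1 + u))))
        * Real.exp (-(R ^ 2 * (1 + u) / (2 * u)) * (s - (a + u * e) / (R ^ 2 * (1 + u))) ^ 2) := by
    intro s
    rw [mixtureDensity, mul_assoc (Real.sqrt _), mul_assoc (Real.sqrt _), mul_assoc (Real.sqrt _),
      ← Real.exp_add, ← Real.exp_add, ← Real.exp_add]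
    congr 2
    field_simp
    ring
  simp_rw [hpt]
  simp_rw [ENNReal.ofReal_mul (mul_nonneg (Real.sqrt_nonneg _) (Real.exp_pos _).le)]
  rw [lintegral_const_mul' _ _ ENNReal.ofReal_ne_top, lintegral_exp_neg_mul_sub_sq (by positivity),
    ← ENNReal.ofReal_mul (by positivity)]
  congr 1
  rw [mul_right_comm, ← Real.sqrt_mul (by positivity)]
  congr 1
  rw [← Real.sqrt_one, ← Real.sqrt_div zero_le_one]
  congr 1
  field_simp

/-- One step of the self-normalized supermartingale: Gaussian mixture of the exponential
moments of the noise. -/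
theorem lintegral_mixture_step [IsFiniteMeasure μ] (hm : m ≤ mΩ) {R : ℝ} (hR : 0 < R)
    {η : Ω → ℝ} (hη : Measurable η)
    (hint : ∀ s : ℝ, Integrable (fun ω => Real.exp (s * η ω)) μ)
    (hsub : ∀ s : ℝ,
      μ[fun ω => Real.exp (s * η ω) | m] ≤ᵐ[μ] fun _ => Real.exp (s ^ 2 * R ^ 2 / 2))
    {M a u : Ω → ℝ} (hM : Measurable[m] M) (ha : Measurable[m] a) (hu : Measurable[m] u)
    (hM0 : ∀ ω, 0 ≤ M ω) (hu0 : ∀ ω, 0 ≤ u ω) (hau : ∀ ω, u ω = 0 → a ω = 0) :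
    ∫⁻ ω, ENNReal.ofReal (M ω * (1 / Real.sqrt (1 + u ω)
        * Real.exp ((u ω * η ω ^ 2 + 2 * a ω * η ω - a ω ^ 2) / (2 * R ^ 2 * (1 + u ω))))) ∂μ
      ≤ ∫⁻ ω, ENNReal.ofReal (M ω) ∂μ := by
  have hM' := hM.mono hm le_rfl
  have ha' := ha.mono hm le_rfl
  have hu' := hu.mono hm le_rfl
  -- Where u = 0 the mixing law degenerates and `mixtureDensity` is 0, while the one-step factor is
  -- 1 because a = 0. `Z` carries the mass of `M` on that event.
  set Z : Ω → ENNReal := {ω | u ω = 0}.indicator fun ω => ENNReal.ofReal (M ω) with hZ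
  have hZm : Measurable Z :=
    (ENNReal.measurable_ofReal.comp hM').indicator (hu' (measurableSet_singleton 0))
  have h1 : ∀ ω, ENNReal.ofReal (M ω * (1 / Real.sqrt (1 + u ω)
        * Real.exp ((u ω * η ω ^ 2 + 2 * a ω * η ω - a ω ^ 2) / (2 * R ^ 2 * (1 + u ω)))))
      ≤ (∫⁻ s, ENNReal.ofReal (Real.exp (s * η ω)) * ENNReal.ofReal (M ω
          * (mixtureDensity R (a ω) (u ω) s * Real.exp (-(s ^ 2 * R ^ 2 / 2))))) + Z ω := by
    intro ω
    rcases eq_or_lt_of_le (hu0 ω) with h | h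
    · simp [hZ, ← h, hau ω h.symm]
    · refine le_add_right (le_of_eq ?_)
      rw [ENNReal.ofReal_mul (hM0 ω), ← lintegral_mixtureDensity_mul_exp hR h,
        ← lintegral_const_mul' _ _ ENNReal.ofReal_ne_top]
      refine lintegral_congr fun s => ?_
      rw [← ENNReal.ofReal_mul (hM0 ω), ← ENNReal.ofReal_mul (Real.exp_pos _).le]
      congr 1
      ring
  have h2 : ∀ ω, (∫⁻ s, ENNReal.ofReal (M ω * mixtureDensity R (a ω) (u ω) s)) + Z ω
      ≤ ENNReal.ofReal (M ω) := by
    intro ω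
    rcases eq_or_lt_of_le (hu0 ω) with h | h
    · simp [hZ, ← h, mixtureDensity]
    · simp_rw [ENNReal.ofReal_mul (hM0 ω)]
      rw [lintegral_const_mul' _ _ ENNReal.ofReal_ne_top, lintegral_mixtureDensity hR h]
      simp [hZ, h.ne']
  have hk : Measurable fun p : Ω × ℝ => mixtureDensity R (a p.1) (u p.1) p.2 := by
    unfold mixtureDensity; fun_prop
  refine (lintegral_mono h1).trans ?_
  refine le_trans ?_ (lintegral_mono h2)
  rw [lintegral_add_right _ hZm, lintegral_add_right _ hZm]
  refine add_le_add_left ?_ _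
  have hk2 : Measurable fun p : Ω × ℝ => M p.1 * mixtureDensity R (a p.1) (u p.1) p.2 := by fun_prop
  have hk1 : Measurable fun p : Ω × ℝ => ENNReal.ofReal (Real.exp (p.2 * η p.1))
      * ENNReal.ofReal (M p.1
        * (mixtureDensity R (a p.1) (u p.1) p.2 * Real.exp (-(p.2 ^ 2 * R ^ 2 / 2)))) := by
    fun_prop
  -- Tonelli moves the s-integral outside, so the conditional bound is needed only for deterministic
  -- s; its constant exp(s²R²/2) then cancels the compensator in the mixture.
  have hswap1 := lintegral_lintegral_swap (μ := μ) (ν := (volume : Measure ℝ))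
    (f := fun ω s => ENNReal.ofReal (Real.exp (s * η ω)) * ENNReal.ofReal (M ω
        * (mixtureDensity R (a ω) (u ω) s * Real.exp (-(s ^ 2 * R ^ 2 / 2))))) hk1.aemeasurable
  have hswap2 := lintegral_lintegral_swap (μ := μ) (ν := (volume : Measure ℝ))
    (f := fun ω s => ENNReal.ofReal (M ω * mixtureDensity R (a ω) (u ω) s))
    hk2.ennreal_ofReal.aemeasurable
  rw [hswap1, hswap2]
  refine lintegral_mono fun s => ?_
  have hG : Measurable[m] fun ω => ENNReal.ofReal (M ω
      * (mixtureDensity R (a ω) (u ω) s * Real.exp (-(s ^ 2 * R ^ 2 / 2)))) := by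
    unfold mixtureDensity; fun_prop
  refine (lintegral_mul_exp_le hm hη (hint s) (hsub s) hG).trans (le_of_eq ?_)
  rw [← lintegral_const_mul' _ _ ENNReal.ofReal_ne_top]
  refine lintegral_congr fun ω => ?_
  rw [← ENNReal.ofReal_mul (Real.exp_pos _).le]
  congr 1
  rw [show M ω * mixtureDensity R (a ω) (u ω) s = M ω * mixtureDensity R (a ω) (u ω) s
    * (Real.exp (s ^ 2 * R ^ 2 / 2) * Real.exp (-(s ^ 2 * R ^ 2 / 2))) by
      rw [← Real.exp_add, add_neg_cancel, Real.exp_zero, mul_one]]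
  ring

/-- Noise that is conditionally `0`-sub-Gaussian vanishes. -/
theorem ae_eq_zero_of_subgaussian_zero [IsProbabilityMeasure μ] (hm : m ≤ mΩ) {η : Ω → ℝ}
    (hint : ∀ s : ℝ, Integrable (fun ω => Real.exp (s * η ω)) μ)
    (hsub : ∀ s : ℝ, μ[fun ω => Real.exp (s * η ω) | m] ≤ᵐ[μ] fun _ => 1) :
    ∀ᵐ ω ∂μ, η ω = 0 := by
  have hle : ∀ s : ℝ, ∫ ω, Real.exp (s * η ω) ∂μ ≤ 1 := by
    intro s
    rw [← integral_condExp hm]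
    refine (integral_mono_ae integrable_condExp (integrable_const 1) (hsub s)).trans ?_
    simp
  -- The integrand is 2 cosh η − 2, nonnegative and zero only at η = 0, while the moment bounds at s
  -- = ±1 make its mean at most 0.
  have h0 : 0 ≤ fun ω => Real.exp (1 * η ω) + Real.exp ((-1) * η ω) - 2 := by
    intro ω
    have := Real.one_le_cosh (η ω)
    rw [Real.cosh_eq] at this
    simp only [Pi.zero_apply, one_mul, neg_mul]
    linarith
  have hi : Integrable (fun ω => Real.exp (1 * η ω) + Real.exp ((-1) * η ω) - 2) μ :=
    ((hint 1).add (hint (-1))).sub (integrable_const 2)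
  have hz : ∫ ω, (Real.exp (1 * η ω) + Real.exp ((-1) * η ω) - 2) ∂μ = 0 := by
    refine le_antisymm ?_ (integral_nonneg h0)
    have hadd : Integrable (fun ω => Real.exp (1 * η ω) + Real.exp ((-1) * η ω)) μ :=
      (hint 1).add (hint (-1))
    rw [integral_sub hadd (integrable_const 2),
      integral_add (hint 1) (hint (-1))]
    have h1 := hle 1
    have h2 := hle (-1)
    simp only [integral_const, probReal_univ, one_smul]
    linarith
  filter_upwards [(integral_eq_zero_iff_of_nonneg h0 hi).1 hz] with ω hω
  by_contra hne
  have := Real.one_lt_cosh.2 hne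
  rw [Real.cosh_eq] at this
  simp only [Pi.zero_apply, one_mul, neg_mul] at hω
  linarith

end SubGaussian

end BiasOFUL

namespace BiasOFUL

/-! ### Measurability of determinants, inverses and quadratic forms. -/

section Measurability

variable {Ω : Type*} [MeasurableSpace Ω] {n : Type*} [Fintype n] [DecidableEq n]

theorem measurable_det {A : Ω → Matrix n n ℝ} (hA : ∀ i j, Measurable fun ω => A ω i j) :
    Measurable fun ω => (A ω).det := by
  simp only [det_apply']
  fun_prop

theorem measurable_inv_apply {A : Ω → Matrix n n ℝ} (hA : ∀ i j, Measurable fun ω => A ω i j)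
    (i j : n) : Measurable fun ω => (A ω)⁻¹ i j := by
  simp only [inv_def, Ring.inverse_eq_inv', Matrix.smul_apply, adjugate_apply, smul_eq_mul]
  refine (measurable_det hA).inv.mul (measurable_det fun k l => ?_)
  simp only [updateRow_apply]
  split_ifs
  · exact measurable_const
  · exact hA k l

theorem measurable_dotProduct_mulVec {n : Type*} [Fintype n] {A : Ω → Matrix n n ℝ} {y z : Ω → n → ℝ}
    (hA : ∀ i j, Measurable fun ω => A ω i j) (hy : ∀ i, Measurable fun ω => y ω i)
    (hz : ∀ i, Measurable fun ω => z ω i) : Measurable fun ω => y ω ⬝ᵥ (A ω *ᵥ z ω) := by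
  simp only [dotProduct, mulVec]
  fun_prop

end Measurability

/-- The accumulated noise `∑_{s < t} η_s x_s`. -/
noncomputable def noiseSum {d : ℕ} (x : ℕ → Vec d) (η : ℕ → ℝ) (t : ℕ) : Fin d → ℝ :=
  ∑ s ∈ Finset.range t, η s • (x s).ofLp

/-- The squared self-normalized noise `‖∑_{s < t} η_s x_s‖²_{V_t⁻¹}`. -/
noncomputable def noiseForm {d : ℕ} (lam : ℝ) (x : ℕ → Vec d) (η : ℕ → ℝ) (t : ℕ) : ℝ :=
  noiseSum x η t ⬝ᵥ ((designMatrix lam x t)⁻¹ *ᵥ noiseSum x η t)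

/-- The self-normalized supermartingale
`(det (lam I) / det V_t)^{1/2} exp (‖∑_{s < t} η_s x_s‖²_{V_t⁻¹} / (2 R²))`. -/
noncomputable def selfNorm {d : ℕ} (lam R : ℝ) (x : ℕ → Vec d) (η : ℕ → ℝ) (t : ℕ) : ℝ :=
  Real.sqrt (lam ^ d / (designMatrix lam x t).det)
    * Real.exp (noiseForm lam x η t / (2 * R ^ 2))

/-! ### One-step recursions and measurability of the self-normalized process. -/

section Paths

variable {d : ℕ}

theorem selfNorm_nonneg (lam R : ℝ) (x : ℕ → Vec d) (η : ℕ → ℝ) (t : ℕ) :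
    0 ≤ selfNorm lam R x η t := by
  unfold selfNorm; positivity

theorem selfNorm_zero {lam : ℝ} (hlam : 0 < lam) (R : ℝ) (x : ℕ → Vec d) (η : ℕ → ℝ) :
    selfNorm lam R x η 0 = 1 := by
  simp [selfNorm, noiseForm, noiseSum, det_designMatrix_zero, (pow_pos hlam d).ne']

theorem noiseForm_succ {lam : ℝ} (hlam : 0 < lam) (x : ℕ → Vec d) (η : ℕ → ℝ) (t : ℕ) :
    noiseForm lam x η (t + 1) = noiseForm lam x η t
      + (potential lam x t * η t ^ 2
          + 2 * ((x t).ofLp ⬝ᵥ ((designMatrix lam x t)⁻¹ *ᵥ noiseSum x η t)) * η t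
          - ((x t).ofLp ⬝ᵥ ((designMatrix lam x t)⁻¹ *ᵥ noiseSum x η t)) ^ 2)
        / (1 + potential lam x t) := by
  have h := quadForm_rank_one_update (designMatrix_posDef hlam x t) (x t).ofLp
    (noiseSum x η t) (η t)
  rw [← designMatrix_succ] at h
  rw [noiseForm, noiseSum, Finset.sum_range_succ]
  exact h

theorem selfNorm_succ {lam R : ℝ} (hlam : 0 < lam) (x : ℕ → Vec d) (η : ℕ → ℝ)
    (t : ℕ) :
    selfNorm lam R x η (t + 1) = selfNorm lam R x η t * (1 / Real.sqrt (1 + potential lam x t)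
      * Real.exp ((potential lam x t * η t ^ 2
          + 2 * ((x t).ofLp ⬝ᵥ ((designMatrix lam x t)⁻¹ *ᵥ noiseSum x η t)) * η t
          - ((x t).ofLp ⬝ᵥ ((designMatrix lam x t)⁻¹ *ᵥ noiseSum x η t)) ^ 2)
        / (2 * R ^ 2 * (1 + potential lam x t)))) := by
  have hu := potential_nonneg hlam x t
  have hdet := (designMatrix_posDef hlam x t).det_pos
  rw [selfNorm, noiseForm_succ hlam, add_div, Real.exp_add, selfNorm, designMatrix_succ,
    det_add_vecMulVec_self (designMatrix_posDef hlam x t)]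
  rw [← div_div, Real.sqrt_div (by positivity)]
  change _ / Real.sqrt (1 + potential lam x t) * _ = _
  rw [div_div _ _ (2 * R ^ 2), mul_comm (1 + potential lam x t) (2 * R ^ 2)]
  ring

theorem measurable_coord {Ω : Type*} [MeasurableSpace Ω] {z : Ω → Vec d} (hz : Measurable z)
    (i : Fin d) : Measurable fun ω => (z ω).ofLp i :=
  (EuclideanSpace.proj (𝕜 := ℝ) i).continuous.measurable.comp hz

variable {Ω : Type*} [MeasurableSpace Ω] {x : ℕ → Ω → Vec d} {η : ℕ → Ω → ℝ} {t : ℕ}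

theorem measurable_designMatrix_apply (lam : ℝ) (hx : ∀ s < t, Measurable (x s)) (i j : Fin d) :
    Measurable fun ω => designMatrix lam (fun s => x s ω) t i j := by
  simp only [designMatrix, Matrix.add_apply, Matrix.sum_apply, vecMulVec_apply]
  refine measurable_const.add (Finset.measurable_sum _ fun s hs => ?_)
  have := hx s (Finset.mem_range.1 hs)
  exact (measurable_coord this i).mul (measurable_coord this j)

theorem measurable_noiseSum_apply (hx : ∀ s < t, Measurable (x s)) (hη : ∀ s < t, Measurable (η s))
    (i : Fin d) : Measurable fun ω => noiseSum (fun s => x s ω) (fun s => η s ω) t i := by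
  simp only [noiseSum, Finset.sum_apply, Pi.smul_apply, smul_eq_mul]
  refine Finset.measurable_sum _ fun s hs => ?_
  exact (hη s (Finset.mem_range.1 hs)).mul (measurable_coord (hx s (Finset.mem_range.1 hs)) i)

theorem measurable_selfNorm (lam R : ℝ) (hx : ∀ s < t, Measurable (x s))
    (hη : ∀ s < t, Measurable (η s)) :
    Measurable fun ω => selfNorm lam R (fun s => x s ω) (fun s => η s ω) t := by
  have h1 := measurable_det (measurable_designMatrix_apply lam hx)
  have h2 : Measurable fun ω => noiseForm lam (fun s => x s ω) (fun s => η s ω) t :=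
    measurable_dotProduct_mulVec (measurable_inv_apply (measurable_designMatrix_apply lam hx))
      (measurable_noiseSum_apply hx hη) (measurable_noiseSum_apply hx hη)
  unfold selfNorm
  fun_prop

end Paths

/-! ### The self-normalized process has mean at most one. -/

section Supermartingale

variable {d : ℕ} {Ω : Type*} {mΩ : MeasurableSpace Ω} {μ : Measure Ω} [IsProbabilityMeasure μ]
  {ℱ : Filtration ℕ mΩ} {T : ℕ} {L R : ℝ} {w : Vec d} {𝒟 : ℕ → Ω → Set (Vec d)} {η : ℕ → Ω → ℝ}
  {xstar x : ℕ → Ω → Vec d}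

theorem lintegral_selfNorm_le_one {lam : ℝ} (hlam : 0 < lam) (hR : 0 < R)
    (hB : IsLinearBandit μ ℱ T L R w 𝒟 η xstar) (hx : ∀ t < T, Measurable[ℱ t] (x t))
    {t : ℕ} (ht : t ≤ T) :
    ∫⁻ ω, ENNReal.ofReal (selfNorm lam R (fun s => x s ω) (fun s => η s ω) t) ∂μ ≤ 1 := by
  induction t with
  | zero => simp [selfNorm_zero hlam]
  | succ t ih =>
    refine le_trans ?_ (ih (Nat.le_of_succ_le ht))
    have htT : t < T := ht
    have hxt : ∀ s < t, Measurable[ℱ t] (x s) := fun s hs =>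
      (hx s (hs.trans htT)).mono (ℱ.mono hs.le) le_rfl
    -- The noise of round s is revealed only at time s + 1, which is at most t.
    have hηt : ∀ s < t, Measurable[ℱ t] (η s) := fun s hs =>
      (hB.noise_measurable s (hs.trans htT)).mono (ℱ.mono hs) le_rfl
    have hxc : ∀ i, Measurable[ℱ t] fun ω => (x t ω).ofLp i := fun i =>
      @measurable_coord d Ω (ℱ t) _ (hx t htT) i
    have hV := @measurable_inv_apply Ω (ℱ t) _ _ _ _
      (@measurable_designMatrix_apply d Ω (ℱ t) x t lam hxt)
    simp_rw [selfNorm_succ hlam]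
    refine lintegral_mixture_step (ℱ.le t) hR ((hB.noise_measurable t htT).mono (ℱ.le _) le_rfl)
      (hB.noise_integrable_exp t htT) (hB.noise_subgaussian t htT)
      (@measurable_selfNorm d Ω (ℱ t) x η t lam R hxt hηt)
      (@measurable_dotProduct_mulVec Ω (ℱ t) _ _ _ _ _ hV hxc
        (@measurable_noiseSum_apply d Ω (ℱ t) x η t hxt hηt))
      (@measurable_dotProduct_mulVec Ω (ℱ t) _ _ _ _ _ hV hxc hxc)
      (fun _ => selfNorm_nonneg _ _ _ _ _) (fun _ => potential_nonneg hlam _ _) ?_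
    intro ω h0
    -- Cauchy–Schwarz for V⁻¹: zero potential forces the cross term with the accumulated noise to
    -- vanish.
    have hcs := sq_dotProduct_mulVec_le
      (designMatrix_posDef hlam (fun s => x s ω) t).inv.posSemidef (x t ω).ofLp
      (noiseSum (fun s => x s ω) (fun s => η s ω) t)
    rw [show (x t ω).ofLp ⬝ᵥ ((designMatrix lam (fun s => x s ω) t)⁻¹ *ᵥ (x t ω).ofLp) = 0 from h0,
      zero_mul] at hcs
    exact pow_eq_zero_iff two_ne_zero |>.1 (le_antisymm hcs (sq_nonneg _))

end Supermartingale

end BiasOFUL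

namespace BiasOFUL

/-! ### Estimation error, confidence radius and optimism. -/

section Confidence

variable {d : ℕ}

theorem inner_eq_dotProduct (y z : Vec d) : inner ℝ y z = y.ofLp ⬝ᵥ z.ofLp := by
  rw [EuclideanSpace.inner_eq_star_dotProduct, star_trivial, dotProduct_comm]

/-- The estimation error of biased ridge regression. -/
theorem inner_biasedEstimate_sub {lam : ℝ} (hlam : 0 < lam) (h w z : Vec d) (x : ℕ → Vec d)
    (η : ℕ → ℝ) (t : ℕ) :
    inner ℝ z (biasedEstimate lam h x (fun s => inner ℝ (x s) w + η s) t) - inner ℝ z w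
      = z.ofLp ⬝ᵥ ((designMatrix lam x t)⁻¹ *ᵥ (noiseSum x η t + lam • (h - w).ofLp)) := by
  -- Since ∑ x_s x_sᵀ = V − λI, the regression vector splits into the noise, the regularization
  -- bias, and V(w − h), which V⁻¹ inverts exactly.
  have hsum : ∑ s ∈ Finset.range t, (inner ℝ (x s) w + η s - inner ℝ (x s) h) • (x s).ofLp
      = noiseSum x η t + lam • (h - w).ofLp + designMatrix lam x t *ᵥ (w - h).ofLp := by
    rw [designMatrix, add_mulVec, smul_mulVec, one_mulVec, sum_mulVec, noiseSum]
    simp only [vecMulVec_mulVec, inner_eq_dotProduct, WithLp.ofLp_sub, dotProduct_sub, op_smul_eq_smul]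
    simp only [add_sub_right_comm, add_smul, sub_smul, Finset.sum_add_distrib,
      Finset.sum_sub_distrib, smul_sub]
    abel
  rw [biasedEstimate, hsum, mulVec_add, inv_mulVec_mulVec hlam, inner_add_right,
    inner_eq_dotProduct z (WithLp.toLp 2 _), inner_eq_dotProduct z h, inner_eq_dotProduct z w]
  simp only [WithLp.ofLp_sub, dotProduct_add, dotProduct_sub]
  ring

theorem abs_inner_biasedEstimate_sub_le {lam : ℝ} (hlam : 0 < lam) (h w z : Vec d)
    (x : ℕ → Vec d) (η : ℕ → ℝ) (t : ℕ) :
    |inner ℝ z (biasedEstimate lam h x (fun s => inner ℝ (x s) w + η s) t) - inner ℝ z w|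
      ≤ weightedNorm (designMatrix lam x t)⁻¹ z
        * (Real.sqrt (noiseForm lam x η t) + Real.sqrt lam * ‖h - w‖) := by
  have hV := (designMatrix_posDef hlam x t).inv.posSemidef
  have hcs : ∀ v : Fin d → ℝ, |z.ofLp ⬝ᵥ ((designMatrix lam x t)⁻¹ *ᵥ v)|
      ≤ weightedNorm (designMatrix lam x t)⁻¹ z
        * Real.sqrt (v ⬝ᵥ ((designMatrix lam x t)⁻¹ *ᵥ v)) := by
    intro v
    rw [weightedNorm, ← Real.sqrt_mul (quadForm_inv_nonneg hlam x t _)]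
    exact Real.abs_le_sqrt (sq_dotProduct_mulVec_le hV _ _)
  rw [inner_biasedEstimate_sub hlam, mulVec_add, dotProduct_add, mul_add]
  refine (abs_add_le _ _).trans (add_le_add (hcs _) ((hcs _).trans ?_))
  refine mul_le_mul_of_nonneg_left ?_ (Real.sqrt_nonneg _)
  rw [← Real.sqrt_sq (norm_nonneg (h - w)), ← Real.sqrt_mul hlam.le]
  refine Real.sqrt_le_sqrt ((quadForm_inv_le hlam x t _).trans (le_of_eq ?_))
  rw [smul_dotProduct, dotProduct_smul, dotProduct_self_eq_norm_sq, smul_eq_mul, smul_eq_mul]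
  field_simp

theorem sum_log_potential_nonneg {lam : ℝ} (hlam : 0 < lam) (x : ℕ → Vec d) (t : ℕ) :
    0 ≤ ∑ s ∈ Finset.range t, Real.log (1 + potential lam x s) :=
  Finset.sum_nonneg fun s _ => Real.log_nonneg (by linarith [potential_nonneg hlam x s])

theorem confidenceRadius_eq {lam T : ℝ} (hlam : 0 < lam) (hT : 0 < T) (R : ℝ) (h w : Vec d)
    (x : ℕ → Vec d) (t : ℕ) :
    confidenceRadius lam R (1 / T) h w x t = Real.sqrt lam * ‖h - w‖ + R * Real.sqrt
      (2 * Real.log T + ∑ s ∈ Finset.range t, Real.log (1 + potential lam x s)) := by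
  have hdet := (designMatrix_posDef hlam x t).det_pos
  have h1 : (lam • (1 : Matrix (Fin d) (Fin d) ℝ)).det = lam ^ d := by simp
  rw [confidenceRadius, h1]
  congr 3
  rw [Real.log_div (by positivity) (by positivity), Real.log_mul (by positivity) (by positivity),
    Real.log_sqrt hdet.le, Real.log_sqrt (by positivity), log_det_designMatrix hlam, one_div,
    Real.log_inv]
  ring

theorem selfNorm_pos {lam : ℝ} (hlam : 0 < lam) (R : ℝ) (x : ℕ → Vec d) (η : ℕ → ℝ) (t : ℕ) :
    0 < selfNorm lam R x η t := by
  have := (designMatrix_posDef hlam x t).det_pos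
  unfold selfNorm; positivity

/-- Solving the definition of M for the quadratic form gives the squared noise radius with log T
replaced by log M. -/
theorem noiseForm_eq {lam R : ℝ} (hlam : 0 < lam) (hR : 0 < R) (x : ℕ → Vec d) (η : ℕ → ℝ)
    (t : ℕ) :
    noiseForm lam x η t = R ^ 2 * (2 * Real.log (selfNorm lam R x η t)
      + ∑ s ∈ Finset.range t, Real.log (1 + potential lam x s)) := by
  have hdet := (designMatrix_posDef hlam x t).det_pos
  rw [selfNorm, Real.log_mul (by positivity) (by positivity), Real.log_exp,
    Real.log_sqrt (by positivity), Real.log_div (by positivity) hdet.ne',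
    log_det_designMatrix hlam]
  field_simp
  ring

/-- The noise exceeds its confidence radius by at most a multiple of the supermartingale. -/
theorem sqrt_noiseForm_le {lam R T : ℝ} (hlam : 0 < lam) (hR : 0 < R) (hT : 1 ≤ T)
    (x : ℕ → Vec d) (η : ℕ → ℝ) (t : ℕ) :
    Real.sqrt (noiseForm lam x η t) ≤ R * Real.sqrt
      (2 * Real.log T + ∑ s ∈ Finset.range t, Real.log (1 + potential lam x s))
      + R * Real.sqrt 2 / T * selfNorm lam R x η t := by
  set D := ∑ s ∈ Finset.range t, Real.log (1 + potential lam x s) with hD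
  have hD0 : 0 ≤ D := sum_log_potential_nonneg hlam x t
  have hM := selfNorm_pos hlam R x η t
  set M := selfNorm lam R x η t with hMdef
  have hlT := Real.log_nonneg hT
  have hq : 0 < M / T := by positivity
  -- For q = M/T, log q ≤ q − 1 ≤ q². The square makes the excess linear in M once the root is
  -- taken.
  have hlog : Real.log M - Real.log T ≤ (M / T) ^ 2 := by
    rw [← Real.log_div hM.ne' (by positivity)]
    have := Real.log_le_sub_one_of_pos hq
    nlinarith [sq_nonneg (M / T - 1 / 2)]
  refine Real.sqrt_le_iff.2 ⟨by positivity, ?_⟩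
  rw [noiseForm_eq hlam hR, ← hD, ← hMdef]
  have e : R * Real.sqrt (2 * Real.log T + D) + R * Real.sqrt 2 / T * M
      = R * (Real.sqrt (2 * Real.log T + D) + Real.sqrt 2 * (M / T)) := by ring
  rw [e, mul_pow]
  refine mul_le_mul_of_nonneg_left ?_ (sq_nonneg R)
  rw [add_sq, mul_pow, Real.sq_sqrt (by positivity), Real.sq_sqrt zero_le_two]
  have : 0 ≤ 2 * Real.sqrt (2 * Real.log T + D) * (Real.sqrt 2 * (M / T)) := by positivity
  linarith

/-- Optimism bounds the regret of one round, also when the confidence bound fails by `e`. -/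
theorem inner_sub_le_of_optimistic {lam R δ e : ℝ} (hlam : 0 < lam) (h w z : Vec d)
    (x : ℕ → Vec d) (η : ℕ → ℝ) (t : ℕ)
    (hopt : optimisticIndex lam R δ h w x (fun s => inner ℝ (x s) w + η s) t z
      ≤ optimisticIndex lam R δ h w x (fun s => inner ℝ (x s) w + η s) t (x t))
    (he : Real.sqrt (noiseForm lam x η t) + Real.sqrt lam * ‖h - w‖
      ≤ confidenceRadius lam R δ h w x t + e) :
    inner ℝ (z - x t) w
      ≤ 2 * confidenceRadius lam R δ h w x t * weightedNorm (designMatrix lam x t)⁻¹ (x t)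
        + e * (weightedNorm (designMatrix lam x t)⁻¹ z
          + weightedNorm (designMatrix lam x t)⁻¹ (x t)) := by
  have h1 := abs_le.1 (abs_inner_biasedEstimate_sub_le hlam h w z x η t)
  have h2 := abs_le.1 (abs_inner_biasedEstimate_sub_le hlam h w (x t) x η t)
  have hnn : ∀ y, 0 ≤ weightedNorm (designMatrix lam x t)⁻¹ y := fun _ => Real.sqrt_nonneg _
  have h3 := mul_le_mul_of_nonneg_left he (hnn z)
  have h4 := mul_le_mul_of_nonneg_left he (hnn (x t))
  unfold optimisticIndex at hopt
  rw [inner_sub_left]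
  -- Three comparisons: from z to its index, from that index to the index of the chosen arm by
  -- `hopt`, and from there to the payoff of the chosen arm.
  linarith [h1.1, h2.2]

end Confidence

/-! ### Scalar inequalities that fit the estimates to the stated bound. -/

section Scalar

/-- Uses log(1 + u) ≥ u/(1 + u) and 1 + u ≤ 2 max(1, L)². It converts potentials into their
logarithms. -/
theorem le_two_mul_sq_mul_log {u L : ℝ} (hu : 0 ≤ u) (hL : 0 ≤ L) (huL : u ≤ L ^ 2) :
    u ≤ 2 * max 1 L ^ 2 * Real.log (1 + u) := by
  have h1 : 1 - (1 + u)⁻¹ ≤ Real.log (1 + u) := Real.one_sub_inv_le_log_of_pos (by linarith)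
  have h2 : 1 - (1 + u)⁻¹ = u / (1 + u) := by field_simp; ring
  have hm1 : 1 ≤ max 1 L ^ 2 := one_le_pow₀ (le_max_left _ _)
  have hmL : L ^ 2 ≤ max 1 L ^ 2 := pow_le_pow_left₀ hL (le_max_right _ _) 2
  rw [h2, div_le_iff₀ (by linarith)] at h1
  have h3 : 0 ≤ Real.log (1 + u) := Real.log_nonneg (by linarith)
  nlinarith

/-- Bernoulli's inequality, 1 + mv ≤ (1 + v)^m. -/
theorem log_one_add_mul_le {v m : ℝ} (hv : 0 ≤ v) (hm : 1 ≤ m) :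
    Real.log (1 + m * v) ≤ m * Real.log (1 + v) := by
  rw [← Real.log_rpow (by linarith)]
  exact Real.log_le_log (by positivity) (one_add_mul_self_le_rpow_one_add (by linarith) hm)

/-- The trace bound produces L² inside the logarithm, while the stated bounds have L; the change
costs a factor max(1, L). -/
theorem log_one_add_sq_le {a L : ℝ} (ha : 0 ≤ a) (hL : 0 ≤ L) :
    Real.log (1 + a * L ^ 2) ≤ max 1 L * Real.log (1 + a * L) := by
  refine le_trans (Real.log_le_log (by positivity) ?_)
    (log_one_add_mul_le (mul_nonneg ha hL) (le_max_left 1 L))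
  have := mul_le_mul_of_nonneg_right (le_max_right 1 L) (mul_nonneg ha hL)
  nlinarith

/-- `L / √lam` is controlled by the leading factor of the regret bound. -/
theorem div_sqrt_le {d T lam L : ℝ} (hd : 1 ≤ d) (hT : 1 ≤ T) (hlam : 1 ≤ lam) (hL : 0 ≤ L) :
    L / Real.sqrt lam
      ≤ Real.sqrt 2 * max 1 L * Real.sqrt (T * d * Real.log (1 + T * L / (lam * d))) := by
  have hlog : Real.log (1 + L) ≤ lam * d * Real.log (1 + L / (lam * d)) := by
    have := log_one_add_mul_le (v := L / (lam * d)) (m := lam * d) (by positivity)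
      (one_le_mul_of_one_le_of_one_le hlam hd)
    rwa [mul_div_cancel₀ _ (by positivity)] at this
  have hmono : Real.log (1 + L / (lam * d)) ≤ T * Real.log (1 + T * L / (lam * d)) := by
    have h0 : 0 ≤ Real.log (1 + T * L / (lam * d)) :=
      Real.log_nonneg (by linarith [show 0 ≤ T * L / (lam * d) by positivity])
    refine le_trans (Real.log_le_log (by positivity) ?_) (le_mul_of_one_le_left h0 hT)
    gcongr
    nlinarith
  have hL1 : L ≤ (1 + L) * Real.log (1 + L) := by
    have h1 : 1 - (1 + L)⁻¹ ≤ Real.log (1 + L) := Real.one_sub_inv_le_log_of_pos (by linarith)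
    have h2 : 1 - (1 + L)⁻¹ = L / (1 + L) := by field_simp; ring
    rw [h2, div_le_iff₀ (by linarith)] at h1
    linarith
  rw [div_le_iff₀ (by positivity), mul_assoc, mul_assoc, ← Real.sqrt_mul' _ (by positivity)]
  have h3 : L / (1 + L) ≤ T * d * Real.log (1 + T * L / (lam * d)) * lam := by
    rw [div_le_iff₀ (by linarith)]
    have := mul_le_mul_of_nonneg_left hmono (show 0 ≤ lam * d by positivity)
    nlinarith
  have h4 : L ^ 2 ≤ (Real.sqrt 2 * (max 1 L
      * Real.sqrt (T * d * Real.log (1 + T * L / (lam * d)) * lam))) ^ 2 := by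
    rw [mul_pow, mul_pow, Real.sq_sqrt zero_le_two, Real.sq_sqrt (le_trans (by positivity) h3)]
    have hm1 : 1 ≤ max 1 L := le_max_left _ _
    have hmL : L ≤ max 1 L := le_max_right _ _
    have h5 : L * (1 + L) ≤ 2 * max 1 L ^ 2 := by nlinarith
    have h6 : L ^ 2 = L * (1 + L) * (L / (1 + L)) := by field_simp
    -- Writing L² as L(1 + L) · L/(1 + L) lets the logarithm bound the second factor, also for small
    -- L.
    rw [h6, ← mul_assoc]
    exact mul_le_mul h5 h3 (by positivity) (by positivity)
  exact le_of_sq_le_sq h4 (by positivity)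

/-- For q = 1 − 1/T in [0, 1], q² ≤ q ≤ log T. Both sides vanish at T = 1, so the first round must
contribute no excess. -/
theorem sub_one_div_le_sqrt_log {T : ℝ} (hT : 1 ≤ T) :
    (T - 1) / T ≤ Real.sqrt (Real.log T) := by
  have hT0 : 0 < T := by linarith
  have h1 : 1 - T⁻¹ ≤ Real.log T := Real.one_sub_inv_le_log_of_pos hT0
  have h2 : (T - 1) / T = 1 - T⁻¹ := by field_simp
  have h3 : 0 ≤ (T - 1) / T := div_nonneg (by linarith) hT0.le
  have h4 : (T - 1) / T ≤ 1 := by rw [div_le_one hT0]; linarith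
  refine Real.le_sqrt_of_sq_le ?_
  nlinarith

end Scalar

end BiasOFUL

namespace BiasOFUL

/-! ### Regret along a fixed path. -/

section Path

variable {d : ℕ}

/-- The elliptical potential lemma, with the weighted norms of the arms summed. -/
theorem sum_weightedNorm_le {lam L : ℝ} (hd : 0 < d) (hlam : 1 ≤ lam) (hL : 0 ≤ L)
    (x : ℕ → Vec d) (T : ℕ) (hx : ∀ s < T, ‖x s‖ ≤ L) :
    ∑ t ∈ Finset.range T, weightedNorm (designMatrix lam x t)⁻¹ (x t)
      ≤ Real.sqrt (2 * max 1 L ^ 3 * (T * d * Real.log (1 + T * L / (lam * d)))) := by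
  have hlam0 : 0 < lam := by linarith
  have hm : 0 ≤ max 1 L := zero_le_one.trans (le_max_left _ _)
  have hsq : ∀ t, weightedNorm (designMatrix lam x t)⁻¹ (x t) ^ 2 = potential lam x t :=
    fun t => Real.sq_sqrt (potential_nonneg hlam0 x t)
  refine Real.le_sqrt_of_sq_le (sq_sum_le_card_mul_sum_sq.trans ?_)
  rw [Finset.card_range]
  have h1 : ∑ t ∈ Finset.range T, weightedNorm (designMatrix lam x t)⁻¹ (x t) ^ 2
      ≤ 2 * max 1 L ^ 2 * ∑ t ∈ Finset.range T, Real.log (1 + potential lam x t) := by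
    rw [Finset.mul_sum]
    refine Finset.sum_le_sum fun t ht => ?_
    rw [hsq]
    refine le_two_mul_sq_mul_log (potential_nonneg hlam0 x t) hL ?_
    refine (quadForm_inv_le hlam0 x t _).trans ?_
    rw [dotProduct_self_eq_norm_sq]
    exact (div_le_self (sq_nonneg _) hlam).trans
      (pow_le_pow_left₀ (norm_nonneg _) (hx t (Finset.mem_range.1 ht)) 2)
  have h2 := sum_log_potential_le hd hlam0 x T hx
  have h3 := log_one_add_sq_le (a := T / (lam * d)) (by positivity) hL
  rw [div_mul_eq_mul_div, div_mul_eq_mul_div] at h3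
  calc (T : ℝ) * ∑ t ∈ Finset.range T, weightedNorm (designMatrix lam x t)⁻¹ (x t) ^ 2
      ≤ T * (2 * max 1 L ^ 2 * (d * (max 1 L * Real.log (1 + T * L / (lam * d))))) := by
        refine mul_le_mul_of_nonneg_left (h1.trans ?_) (Nat.cast_nonneg T)
        exact mul_le_mul_of_nonneg_left
          (h2.trans (mul_le_mul_of_nonneg_left h3 (Nat.cast_nonneg d))) (by positivity)
    _ = _ := by ring

/-- The confidence radius in terms of the second factor of the regret bound. -/
theorem confidenceRadius_le {lam L R : ℝ} (hd : 0 < d) (hlam : 0 < lam) (hL : 0 ≤ L) (hR : 0 ≤ R)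
    (h w : Vec d) (x : ℕ → Vec d) {T t : ℕ} (hT : 0 < T) (ht : t < T)
    (hx : ∀ s < T, ‖x s‖ ≤ L) :
    confidenceRadius lam R (1 / (T : ℝ)) h w x t ≤ Real.sqrt lam * ‖h - w‖
      + R * Real.sqrt (2 * max 1 L * (d * Real.log (T + T ^ 2 * L / (lam * d)))) := by
  have hT1 : (1 : ℝ) ≤ T := by exact_mod_cast hT
  have hd1 : (1 : ℝ) ≤ d := by exact_mod_cast hd
  have hm : 1 ≤ max 1 L := le_max_left _ _
  rw [confidenceRadius_eq hlam (by linarith)]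
  gcongr
  have h1 : ∑ s ∈ Finset.range t, Real.log (1 + potential lam x s)
      ≤ ∑ s ∈ Finset.range T, Real.log (1 + potential lam x s) :=
    Finset.sum_le_sum_of_subset_of_nonneg (Finset.range_mono ht.le) fun s _ _ =>
      Real.log_nonneg (by linarith [potential_nonneg hlam x s])
  have h2 := sum_log_potential_le hd hlam x T hx
  have h3 := log_one_add_sq_le (a := T / (lam * d)) (by positivity) hL
  rw [div_mul_eq_mul_div, div_mul_eq_mul_div] at h3
  have h4 : Real.log (T + T ^ 2 * L / (lam * d))
      = Real.log T + Real.log (1 + T * L / (lam * d)) := by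
    rw [← Real.log_mul (by positivity) (by positivity)]
    congr 1
    ring
  have h5 : 0 ≤ Real.log (1 + T * L / (lam * d)) :=
    Real.log_nonneg (by linarith [show 0 ≤ T * L / (lam * d) by positivity])
  have h6 := Real.log_nonneg hT1
  have h7 : Real.log T ≤ max 1 L * (d * Real.log T) := by
    refine le_trans ?_ (le_mul_of_one_le_left (by positivity) hm)
    exact le_mul_of_one_le_left h6 hd1
  have h8 : 0 ≤ max 1 L * (d * Real.log (1 + T * L / (lam * d))) := by positivity
  have h9 := mul_le_mul_of_nonneg_left h3 (Nat.cast_nonneg d : (0 : ℝ) ≤ d)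
  rw [h4]
  linarith

/-- The regret bound along a path, up to the excess `e` of the noise over its confidence radius. -/
theorem sum_inner_sub_le {lam L R : ℝ} (hd : 0 < d) (hlam : 1 ≤ lam) (hL : 0 ≤ L) (hR : 0 ≤ R)
    (h w : Vec d) (x z : ℕ → Vec d) (η e : ℕ → ℝ) {T : ℕ} (hT : 0 < T)
    (hx : ∀ s < T, ‖x s‖ ≤ L) (hz : ∀ s < T, ‖z s‖ ≤ L) (he0 : ∀ t < T, 0 ≤ e t)
    (hopt : ∀ t < T, optimisticIndex lam R (1 / (T : ℝ)) h w x (fun s => inner ℝ (x s) w + η s) t (z t)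
      ≤ optimisticIndex lam R (1 / (T : ℝ)) h w x (fun s => inner ℝ (x s) w + η s) t (x t))
    (he : ∀ t < T, Real.sqrt (noiseForm lam x η t) + Real.sqrt lam * ‖h - w‖
      ≤ confidenceRadius lam R (1 / (T : ℝ)) h w x t + e t) :
    ∑ t ∈ Finset.range T, inner ℝ (z t - x t) w
      ≤ 4 * max 1 L ^ 2 * Real.sqrt (T * d * Real.log (1 + T * L / (lam * d)))
          * (Real.sqrt lam * ‖h - w‖ + R * Real.sqrt (d * Real.log (T + T ^ 2 * L / (lam * d))))
        + 2 * (L / Real.sqrt lam) * ∑ t ∈ Finset.range T, e t := by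
  have hlam0 : 0 < lam := by linarith
  have hT1 : (1 : ℝ) ≤ T := by exact_mod_cast hT
  have hm : 1 ≤ max 1 L := le_max_left _ _
  set X := (T : ℝ) * d * Real.log (1 + T * L / (lam * d)) with hX
  set Y := (d : ℝ) * Real.log (T + T ^ 2 * L / (lam * d)) with hY
  set H := Real.sqrt lam * ‖h - w‖ with hH
  have hH0 : 0 ≤ H := by positivity
  have hnn : ∀ t y, 0 ≤ weightedNorm (designMatrix lam x t)⁻¹ y := fun _ _ => Real.sqrt_nonneg _
  have hle : ∀ t, ∀ y : Vec d, ‖y‖ ≤ L →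
      weightedNorm (designMatrix lam x t)⁻¹ y ≤ L / Real.sqrt lam := fun t y hy =>
    (weightedNorm_inv_le hlam0 x t y).trans (by gcongr)
  have hround : ∀ t ∈ Finset.range T, inner ℝ (z t - x t) w
      ≤ 2 * (H + R * Real.sqrt (2 * max 1 L * Y)) * weightedNorm (designMatrix lam x t)⁻¹ (x t)
        + 2 * (L / Real.sqrt lam) * e t := by
    intro t ht
    have htT := Finset.mem_range.1 ht
    refine (inner_sub_le_of_optimistic hlam0 h w (z t) x η t (hopt t htT) (he t htT)).trans ?_
    have h1 := mul_le_mul_of_nonneg_right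
      (confidenceRadius_le hd hlam0 hL hR h w x hT htT hx) (hnn t (x t))
    have h2 := mul_le_mul_of_nonneg_left
      (add_le_add (hle t _ (hz t htT)) (hle t _ (hx t htT))) (he0 t htT)
    linarith
  refine (Finset.sum_le_sum hround).trans ?_
  rw [Finset.sum_add_distrib, ← Finset.mul_sum, ← Finset.mul_sum]
  refine add_le_add_left ?_ _
  have hsum := sum_weightedNorm_le hd hlam hL x T hx
  rw [← hX] at hsum
  refine (mul_le_mul_of_nonneg_left hsum (by positivity)).trans ?_
  have hm0 : 0 ≤ max 1 L := by linarith
  have e1 : Real.sqrt (2 * max 1 L * Y) = Real.sqrt 2 * Real.sqrt (max 1 L) * Real.sqrt Y := by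
    rw [Real.sqrt_mul (by positivity), Real.sqrt_mul zero_le_two]
  have e2 : Real.sqrt (2 * max 1 L ^ 3 * X)
      = Real.sqrt 2 * (max 1 L * Real.sqrt (max 1 L)) * Real.sqrt X := by
    rw [Real.sqrt_mul (by positivity), Real.sqrt_mul zero_le_two,
      show max 1 L ^ 3 = max 1 L ^ 2 * max 1 L by ring, Real.sqrt_mul (by positivity),
      Real.sqrt_sq hm0]
  rw [e1, e2]
  have h2 : Real.sqrt 2 * Real.sqrt 2 = 2 := Real.mul_self_sqrt zero_le_two
  have h3 : Real.sqrt (max 1 L) * Real.sqrt (max 1 L) = max 1 L := Real.mul_self_sqrt hm0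
  have h4 : Real.sqrt 2 ≤ 2 := Real.sqrt_le_iff.2 ⟨by norm_num, by norm_num⟩
  have h5 : Real.sqrt (max 1 L) ≤ max 1 L :=
    Real.sqrt_le_iff.2 ⟨hm0, by nlinarith⟩
  have h6 : Real.sqrt 2 * (max 1 L * Real.sqrt (max 1 L)) ≤ 2 * (max 1 L * max 1 L) := by gcongr
  have h7 := mul_le_mul_of_nonneg_right h6 (show 0 ≤ 2 * H * Real.sqrt X by positivity)
  -- The constant 4 max(1, L)² is 2 · √(2m) · √(2m³) with m = max(1, L), from the radius and the
  -- summed widths; the term in `H` needs less and is rounded up.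
  have h8 : 2 * (R * (Real.sqrt 2 * Real.sqrt (max 1 L) * Real.sqrt Y))
      * (Real.sqrt 2 * (max 1 L * Real.sqrt (max 1 L)) * Real.sqrt X)
      = 4 * max 1 L ^ 2 * Real.sqrt X * (R * Real.sqrt Y) := by
    calc _ = 2 * R * (Real.sqrt 2 * Real.sqrt 2) * (Real.sqrt (max 1 L) * Real.sqrt (max 1 L))
        * max 1 L * Real.sqrt X * Real.sqrt Y := by ring
      _ = _ := by rw [h2, h3]; ring
  linarith

end Path

/-! ### Expected excess and expected regret. -/

section Regret

variable {d : ℕ} {Ω : Type*} {mΩ : MeasurableSpace Ω} {μ : Measure Ω} [IsProbabilityMeasure μ]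
  {ℱ : Filtration ℕ mΩ} {T : ℕ} {L R : ℝ} {w : Vec d} {𝒟 : ℕ → Ω → Set (Vec d)} {η : ℕ → Ω → ℝ}
  {xstar x : ℕ → Ω → Vec d}

/-- The expected excess of the noise over its confidence radius is at most `√2 R / T` in each
round, and zero in the first one. -/
theorem exists_noise_excess {lam : ℝ} (hlam : 0 < lam) (hR : 0 ≤ R) (hT : 0 < T) (h : Vec d)
    (hB : IsLinearBandit μ ℱ T L R w 𝒟 η xstar) (hx : ∀ t < T, Measurable[ℱ t] (x t)) :
    ∃ e : ℕ → Ω → ℝ, (∀ t ω, 0 ≤ e t ω) ∧ (∀ t < T, Integrable (e t) μ) ∧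
      (∀ t < T, ∫ ω, e t ω ∂μ ≤ if t = 0 then 0 else R * Real.sqrt 2 / T) ∧
      ∀ᵐ ω ∂μ, ∀ t < T, Real.sqrt (noiseForm lam (fun s => x s ω) (fun s => η s ω) t)
          + Real.sqrt lam * ‖h - w‖
        ≤ confidenceRadius lam R (1 / (T : ℝ)) h w (fun s => x s ω) t + e t ω := by
  have hT1 : (1 : ℝ) ≤ T := by exact_mod_cast hT
  have hT0 : (0 : ℝ) < T := by linarith
  -- The self-normalized process divides by R², so R = 0 is separate: the noise then vanishes almost
  -- surely.
  rcases eq_or_lt_of_le hR with rfl | hRpos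
  · refine ⟨fun _ _ => 0, fun _ _ => le_rfl, fun _ _ => integrable_zero _ _ _,
      fun t _ => by simp, ?_⟩
    have hz : ∀ᵐ ω ∂μ, ∀ s, s < T → η s ω = 0 := by
      refine ae_all_iff.2 fun s => ?_
      by_cases hs : s < T
      · have := ae_eq_zero_of_subgaussian_zero (ℱ.le s) (hB.noise_integrable_exp s hs)
          (fun r => by simpa using hB.noise_subgaussian s hs r)
        filter_upwards [this] with ω hω _ using hω
      · exact ae_of_all _ fun ω h' => absurd h' hs
    filter_upwards [hz] with ω hω t ht
    have h0 : noiseSum (fun s => x s ω) (fun s => η s ω) t = 0 :=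
      Finset.sum_eq_zero fun s hs => by
        simp [hω s ((Finset.mem_range.1 hs).trans ht)]
    rw [confidenceRadius_eq hlam hT0, noiseForm, h0]
    simp
  · set M : ℕ → Ω → ℝ := fun t ω => selfNorm lam R (fun s => x s ω) (fun s => η s ω) t with hM
    have hMm : ∀ t < T, Measurable (M t) := fun t ht =>
      measurable_selfNorm lam R
        (fun s hs => (hx s (hs.trans ht)).mono (ℱ.le s) le_rfl)
        (fun s hs => (hB.noise_measurable s (hs.trans ht)).mono (ℱ.le _) le_rfl)
    have hM0 : ∀ t ω, 0 ≤ M t ω := fun t ω => selfNorm_nonneg _ _ _ _ _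
    have hlint : ∀ t < T, ∫⁻ ω, ENNReal.ofReal (M t ω) ∂μ ≤ 1 := fun t ht =>
      lintegral_selfNorm_le_one hlam hRpos hB hx ht.le
    have hMi : ∀ t < T, Integrable (M t) μ := fun t ht =>
      ⟨(hMm t ht).aestronglyMeasurable, by
        rw [hasFiniteIntegral_iff_ofReal (ae_of_all _ (hM0 t))]
        exact (hlint t ht).trans_lt ENNReal.one_lt_top⟩
    have hMint : ∀ t < T, ∫ ω, M t ω ∂μ ≤ 1 := fun t ht => by
      rw [integral_eq_lintegral_of_nonneg_ae (ae_of_all _ (hM0 t)) (hMm t ht).aestronglyMeasurable]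
      exact ENNReal.toReal_le_of_le_ofReal zero_le_one (by simpa using hlint t ht)
    refine ⟨fun t ω => if t = 0 then 0 else R * Real.sqrt 2 / T * M t ω, ?_, ?_, ?_, ?_⟩
    · intro t ω
      have := hM0 t ω
      dsimp only
      split_ifs <;> positivity
    · intro t ht
      dsimp only
      split_ifs
      · exact integrable_zero _ _ _
      · exact (hMi t ht).const_mul _
    · intro t ht
      dsimp only
      split_ifs
      · simp
      · rw [integral_const_mul]
        exact mul_le_of_le_one_right (by positivity) (hMint t ht)
    · refine ae_of_all _ fun ω t _ => ?_
      rw [confidenceRadius_eq hlam hT0]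
      dsimp only
      split_ifs with h0
      · subst h0
        simp only [noiseForm, noiseSum, Finset.range_zero, Finset.sum_empty, zero_dotProduct,
          Real.sqrt_zero]
        have : 0 ≤ R * Real.sqrt (2 * Real.log T + 0) := by positivity
        linarith
      · have := sqrt_noiseForm_le hlam hRpos hT1 (fun s => x s ω) (fun s => η s ω) t
        linarith

/-- Payoffs in [−1, 1] bound the regret of each round by 2 in absolute value. -/
theorem integrable_pseudoRegret {lam δ : ℝ} {h : Vec d} (hB : IsLinearBandit μ ℱ T L R w 𝒟 η xstar)
    (hrun : IsBiasOFULRun ℱ T lam R δ h w 𝒟 η x) : Integrable (pseudoRegret T w xstar x) μ := by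
  refine integrable_finsetSum _ fun t ht => ?_
  have htT := Finset.mem_range.1 ht
  have hxm : Measurable (x t) := (hrun.predictable t htT).mono (ℱ.le t) le_rfl
  have hmeas : Measurable fun ω => inner ℝ (xstar t ω - x t ω) w :=
    ((hB.optimal_measurable t htT).sub hxm).inner measurable_const
  refine Integrable.of_bound hmeas.aestronglyMeasurable 2 (ae_of_all _ fun ω => ?_)
  have h1 := hB.payoff_mem t htT ω _ (hB.optimal_mem t htT ω)
  have h2 := hB.payoff_mem t htT ω _ (hrun.arm_mem t htT ω)
  rw [inner_sub_left, Real.norm_eq_abs, abs_le]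
  constructor <;> linarith [h1.1, h1.2, h2.1, h2.2]

/-- The expected pseudo-regret of BIAS-OFUL with an arbitrary bias. -/
theorem integral_pseudoRegret_le {lam : ℝ} {h : Vec d} (hd : 0 < d) (hT : 0 < T) (hlam : 1 ≤ lam)
    (hR : 0 ≤ R) (hB : IsLinearBandit μ ℱ T L R w 𝒟 η xstar)
    (hrun : IsBiasOFULRun ℱ T lam R (1 / (T : ℝ)) h w 𝒟 η x) :
    ∫ ω, pseudoRegret T w xstar x ω ∂μ ≤ itlBound (8 * max 1 (L ^ 2)) d T lam L ‖h - w‖ R := by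
  have hlam0 : 0 < lam := by linarith
  have hT1 : (1 : ℝ) ≤ T := by exact_mod_cast hT
  have hd1 : (1 : ℝ) ≤ d := by exact_mod_cast hd
  have hne : Nonempty Ω := nonempty_of_isProbabilityMeasure μ
  have hxL : ∀ ω, ∀ s < T, ‖x s ω‖ ≤ L := fun ω s hs =>
    hB.norm_le s hs ω _ (hrun.arm_mem s hs ω)
  have hzL : ∀ ω, ∀ s < T, ‖xstar s ω‖ ≤ L := fun ω s hs =>
    hB.norm_le s hs ω _ (hB.optimal_mem s hs ω)
  have hL : 0 ≤ L := (norm_nonneg _).trans (hxL hne.some 0 hT)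
  obtain ⟨e, he0, hei, heint, hae⟩ := exists_noise_excess hlam0 hR hT h hB hrun.predictable
  set X := (T : ℝ) * d * Real.log (1 + T * L / (lam * d)) with hX
  set Y := (d : ℝ) * Real.log (T + T ^ 2 * L / (lam * d)) with hY
  set A := 4 * max 1 L ^ 2 * Real.sqrt X * (Real.sqrt lam * ‖h - w‖ + R * Real.sqrt Y) with hA
  have hpath : ∀ᵐ ω ∂μ, pseudoRegret T w xstar x ω
      ≤ A + 2 * (L / Real.sqrt lam) * ∑ t ∈ Finset.range T, e t ω := by
    filter_upwards [hae] with ω hω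
    exact sum_inner_sub_le hd hlam hL hR h w (fun s => x s ω) (fun s => xstar s ω)
      (fun s => η s ω) (fun s => e s ω) hT (hxL ω) (hzL ω) (fun t _ => he0 t ω)
      (fun t ht => hrun.arm_argmax t ht ω _ (hB.optimal_mem t ht ω)) hω
  have hesum : Integrable (fun ω => ∑ t ∈ Finset.range T, e t ω) μ :=
    integrable_finsetSum _ fun t ht => hei t (Finset.mem_range.1 ht)
  have hI := integral_mono_ae (integrable_pseudoRegret hB hrun)
    ((integrable_const A).add (hesum.const_mul (2 * (L / Real.sqrt lam)))) hpath
  refine hI.trans ?_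
  simp only [Pi.add_apply]
  rw [integral_add (integrable_const A) (hesum.const_mul _),
    integral_const_mul (2 * (L / Real.sqrt lam)),
    integral_finsetSum _ fun t ht => hei t (Finset.mem_range.1 ht), integral_const,
    probReal_univ, one_smul]
  have hexc : ∑ t ∈ Finset.range T, ∫ ω, e t ω ∂μ ≤ R * Real.sqrt 2 * Real.sqrt Y := by
    refine (Finset.sum_le_sum fun t ht => heint t (Finset.mem_range.1 ht)).trans ?_
    have hs : ∑ t ∈ Finset.range T, (if t = 0 then (0 : ℝ) else R * Real.sqrt 2 / T)
        = R * Real.sqrt 2 * ((T - 1) / T) := by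
      obtain ⟨n, rfl⟩ := Nat.exists_eq_succ_of_ne_zero hT.ne'
      rw [Finset.sum_range_succ']
      simp
      ring
    rw [hs]
    refine mul_le_mul_of_nonneg_left ((sub_one_div_le_sqrt_log hT1).trans ?_) (by positivity)
    refine Real.sqrt_le_sqrt ?_
    have h1 : Real.log T ≤ Real.log (T + T ^ 2 * L / (lam * d)) :=
      Real.log_le_log (by linarith) (le_add_of_nonneg_right (by positivity))
    exact h1.trans (le_mul_of_one_le_left ((Real.log_nonneg hT1).trans h1) hd1)
  have hLs := div_sqrt_le hd1 hT1 hlam hL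
  rw [← hX] at hLs
  have hm : 1 ≤ max 1 L := le_max_left _ _
  have h2 : Real.sqrt 2 * Real.sqrt 2 = 2 := Real.mul_self_sqrt zero_le_two
  have hprod := mul_le_mul (mul_le_mul_of_nonneg_left hLs zero_le_two) hexc
    (Finset.sum_nonneg fun t _ => integral_nonneg (he0 t)) (by positivity)
  -- The excess costs no more than the main term `A`, hence the final constant 8 = 4 + 4.
  have hfin : 2 * (Real.sqrt 2 * max 1 L * Real.sqrt X) * (R * Real.sqrt 2 * Real.sqrt Y)
      ≤ 4 * max 1 L ^ 2 * Real.sqrt X * (Real.sqrt lam * ‖h - w‖ + R * Real.sqrt Y) := by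
    have h3 : 2 * (Real.sqrt 2 * max 1 L * Real.sqrt X) * (R * Real.sqrt 2 * Real.sqrt Y)
        = 4 * max 1 L * (Real.sqrt X * (R * Real.sqrt Y)) := by
      linear_combination (2 * max 1 L * Real.sqrt X * R * Real.sqrt Y) * h2
    have h4 : max 1 L ≤ max 1 L ^ 2 := by nlinarith
    have h5 : 0 ≤ Real.sqrt X * (R * Real.sqrt Y) := by positivity
    have h6 : 0 ≤ 4 * max 1 L ^ 2 * Real.sqrt X * (Real.sqrt lam * ‖h - w‖) := by positivity
    rw [h3]
    nlinarith [mul_le_mul_of_nonneg_right h4 h5]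
  have hmax : max 1 (L ^ 2) = max 1 L ^ 2 := by
    rcases le_total 1 L with h | h
    · rw [max_eq_right h, max_eq_right (one_le_pow₀ h)]
    · rw [max_eq_left h, max_eq_left (pow_le_one₀ hL h), one_pow]
  rw [itlBound, hmax, ← hX, ← hY]
  linarith

end Regret

/-! ### Growth in T and d of the bound for bias 0, and the oracle limit. -/

section Rates

theorem log_one_add_natCast_mul_le {L : ℝ} (hL : 0 ≤ L) (T : ℕ) :
    Real.log (1 + T * L) ≤ max 1 L * Real.log (1 + T) := by
  have hT : (0 : ℝ) ≤ T := Nat.cast_nonneg T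
  refine le_trans (Real.log_le_log (by positivity) ?_) (log_one_add_mul_le hT (le_max_left 1 L))
  have := mul_le_mul_of_nonneg_right (le_max_right 1 L) hT
  linarith

/-- The bound for the bias `0` is of order `d √T` up to the logarithm of `T`. -/
theorem itlBound_le {C lam L S R : ℝ} (hC : 0 ≤ C) (hlam : 1 ≤ lam) (hL : 0 ≤ L) (hS : 0 ≤ S)
    (hR : 0 ≤ R) {d T : ℕ} (hd : 0 < d) (hT : 0 < T) :
    itlBound C d T lam L S R ≤ C * Real.sqrt (max 1 L)
      * (Real.sqrt lam * S / Real.sqrt (Real.log 2) + R * Real.sqrt (1 + max 1 L))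
      * (d * Real.sqrt T * Real.log (1 + T)) := by
  have hT1 : (1 : ℝ) ≤ T := by exact_mod_cast hT
  have hd1 : (1 : ℝ) ≤ d := by exact_mod_cast hd
  have hm : 1 ≤ max 1 L := le_max_left _ _
  have hlogT := log_one_add_natCast_mul_le hL T
  have hl2 : 0 < Real.log 2 := Real.log_pos one_lt_two
  have hl : Real.log 2 ≤ Real.log (1 + T) := Real.log_le_log two_pos (by linarith)
  set ℓ := Real.log (1 + T) with hℓ
  have hℓ0 : 0 < ℓ := hl2.trans_le hl
  have hfrac : T * L / (lam * d) ≤ T * L :=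
    div_le_self (by positivity) (one_le_mul_of_one_le_of_one_le hlam hd1)
  have h1 : Real.log (1 + T * L / (lam * d)) ≤ max 1 L * ℓ :=
    (Real.log_le_log (by positivity) (by linarith)).trans hlogT
  have h2 : Real.log (T + T ^ 2 * L / (lam * d)) ≤ (1 + max 1 L) * ℓ := by
    rw [show T + T ^ 2 * L / (lam * d) = T * (1 + T * L / (lam * d)) by ring,
      Real.log_mul (by positivity) (by positivity)]
    have := Real.log_le_log (by linarith : (0 : ℝ) < T) (by linarith : (T : ℝ) ≤ 1 + T)
    linarith
  have e1 : Real.sqrt (T * d * Real.log (1 + T * L / (lam * d)))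
      ≤ Real.sqrt T * Real.sqrt d * (Real.sqrt (max 1 L) * Real.sqrt ℓ) := by
    rw [← Real.sqrt_mul (by positivity), ← Real.sqrt_mul (by positivity),
      ← Real.sqrt_mul (by positivity)]
    gcongr
  have e2 : Real.sqrt (d * Real.log (T + T ^ 2 * L / (lam * d)))
      ≤ Real.sqrt d * (Real.sqrt (1 + max 1 L) * Real.sqrt ℓ) := by
    rw [← Real.sqrt_mul (by positivity), ← Real.sqrt_mul (by positivity)]
    gcongr
  -- This term carries no logarithm; log(1 + T) ≥ log 2 supplies one at the cost of 1/√(log 2),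
  -- uniformly in d and T.
  have e3 : Real.sqrt lam * S
      ≤ Real.sqrt lam * S / Real.sqrt (Real.log 2) * (Real.sqrt d * Real.sqrt ℓ) := by
    rw [div_mul_eq_mul_div, le_div_iff₀ (Real.sqrt_pos.2 hl2)]
    refine mul_le_mul_of_nonneg_left ?_ (by positivity)
    refine (Real.sqrt_le_sqrt hl).trans (le_mul_of_one_le_left (Real.sqrt_nonneg _) ?_)
    exact Real.one_le_sqrt.2 hd1
  have e4 : Real.sqrt lam * S + R * Real.sqrt (d * Real.log (T + T ^ 2 * L / (lam * d)))
      ≤ (Real.sqrt lam * S / Real.sqrt (Real.log 2) + R * Real.sqrt (1 + max 1 L))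
        * (Real.sqrt d * Real.sqrt ℓ) := by
    have := mul_le_mul_of_nonneg_left e2 hR
    linarith
  have hdd : Real.sqrt d * Real.sqrt d = d := Real.mul_self_sqrt (by positivity)
  have hll : Real.sqrt ℓ * Real.sqrt ℓ = ℓ := Real.mul_self_sqrt hℓ0.le
  rw [itlBound]
  refine (mul_le_mul (mul_le_mul_of_nonneg_left e1 hC) e4 (by positivity) (by positivity)).trans
    (le_of_eq ?_)
  calc _ = C * Real.sqrt (max 1 L)
        * (Real.sqrt lam * S / Real.sqrt (Real.log 2) + R * Real.sqrt (1 + max 1 L))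
        * ((Real.sqrt d * Real.sqrt d) * Real.sqrt T * (Real.sqrt ℓ * Real.sqrt ℓ)) := by ring
    _ = _ := by rw [hdd, hll]

/-- The oracle bound vanishes as the regularization grows. -/
theorem tendsto_oracleBound (C L R : ℝ) {d T : ℕ} (hd : 0 < d) (hT : 0 < T) :
    Tendsto (fun lam : ℝ => oracleBound C d T lam L R) atTop (𝓝 0) := by
  have hd0 : (0 : ℝ) < d := by exact_mod_cast hd
  have hT0 : (T : ℝ) ≠ 0 := by exact_mod_cast hT.ne'
  have hfrac : ∀ c : ℝ, Tendsto (fun lam : ℝ => c / (lam * d)) atTop (𝓝 0) := fun c =>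
    tendsto_const_nhds.div_atTop (tendsto_id.atTop_mul_const hd0)
  -- The first logarithm tends to log 1 = 0 while the second stays bounded, with limit log T.
  have h1 : Tendsto (fun lam : ℝ => Real.log (1 + T * L / (lam * d))) atTop (𝓝 0) := by
    have := ((tendsto_const_nhds (x := (1 : ℝ))).add (hfrac (T * L))).log (by simp)
    simpa using this
  have h2 : Tendsto (fun lam : ℝ => Real.log (T + T ^ 2 * L / (lam * d))) atTop
      (𝓝 (Real.log T)) := by
    have := ((tendsto_const_nhds (x := (T : ℝ))).add (hfrac (T ^ 2 * L))).log (by simpa using hT0)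
    simpa using this
  have h3 := (((h1.const_mul (T * d : ℝ)).sqrt).const_mul C).mul
    (((h2.const_mul (d : ℝ)).sqrt).const_mul R)
  simpa [oracleBound] using h3

end Rates

end BiasOFUL

theorem mainTheorem7 :
    ∃ C₀ : ℝ, 0 < C₀ ∧
      -- (i) the bias `h = 0`: the regret bound
      (∀ (d T : ℕ) (lam L S R : ℝ), 0 < d → 0 < T → 1 ≤ lam → 0 ≤ R →
        ∀ (Ω : Type*) (mΩ : MeasurableSpace Ω) (μ : Measure Ω) [IsProbabilityMeasure μ]
          (ℱ : Filtration ℕ mΩ) (w : BiasOFUL.Vec d) (𝒟 : ℕ → Ω → Set (BiasOFUL.Vec d))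
          (η : ℕ → Ω → ℝ) (xstar x : ℕ → Ω → BiasOFUL.Vec d),
          ‖w‖ ≤ S →
          BiasOFUL.IsLinearBandit μ ℱ T L R w 𝒟 η xstar →
          BiasOFUL.IsBiasOFULRun ℱ T lam R (1 / (T : ℝ)) 0 w 𝒟 η x →
          Integrable (BiasOFUL.pseudoRegret T w xstar x) μ ∧
            ∫ ω, BiasOFUL.pseudoRegret T w xstar x ω ∂μ
              ≤ BiasOFUL.itlBound (C₀ * max 1 (L ^ 2)) d T lam L S R) ∧
      -- (i) the bias `h = 0`: for every fixed `lam ≥ 1` the bound is of order `d √T`,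
      -- up to the logarithm of `T`
      (∀ lam L S R : ℝ, 1 ≤ lam → 0 ≤ L → 0 ≤ S → 0 ≤ R →
        ∃ K : ℝ, ∀ d T : ℕ, 0 < d → 0 < T →
          BiasOFUL.itlBound (C₀ * max 1 (L ^ 2)) d T lam L S R
            ≤ K * (d * Real.sqrt T * Real.log (1 + T))) ∧
      -- (ii) the oracle bias `h = w`: the regret bound
      (∀ (d T : ℕ) (lam L R : ℝ), 0 < d → 0 < T → 1 ≤ lam → 0 ≤ R →
        ∀ (Ω : Type*) (mΩ : MeasurableSpace Ω) (μ : Measure Ω) [IsProbabilityMeasure μ]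
          (ℱ : Filtration ℕ mΩ) (w : BiasOFUL.Vec d) (𝒟 : ℕ → Ω → Set (BiasOFUL.Vec d))
          (η : ℕ → Ω → ℝ) (xstar x : ℕ → Ω → BiasOFUL.Vec d),
          BiasOFUL.IsLinearBandit μ ℱ T L R w 𝒟 η xstar →
          BiasOFUL.IsBiasOFULRun ℱ T lam R (1 / (T : ℝ)) w w 𝒟 η x →
          Integrable (BiasOFUL.pseudoRegret T w xstar x) μ ∧
            ∫ ω, BiasOFUL.pseudoRegret T w xstar x ω ∂μ
              ≤ BiasOFUL.oracleBound (C₀ * max 1 (L ^ 2)) d T lam L R) ∧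
      -- (ii) the oracle bias `h = w`: the bound vanishes as `lam → ∞`
      (∀ (d T : ℕ) (L R : ℝ), 0 < d → 0 < T → 0 ≤ L → 0 ≤ R →
        Tendsto (fun lam : ℝ => BiasOFUL.oracleBound (C₀ * max 1 (L ^ 2)) d T lam L R)
          atTop (𝓝 0)) := by
  refine ⟨8, by norm_num, ?_, ?_, ?_, ?_⟩
  · intro d T lam L S R hd hT hlam hR Ω mΩ μ _ ℱ w 𝒟 η xstar x hS hB hrun
    refine ⟨BiasOFUL.integrable_pseudoRegret hB hrun,
      (BiasOFUL.integral_pseudoRegret_le hd hT hlam hR hB hrun).trans ?_⟩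
    rw [zero_sub, norm_neg]
    unfold BiasOFUL.itlBound
    gcongr
  · intro lam L S R hlam hL hS hR
    exact ⟨_, fun d T hd hT => BiasOFUL.itlBound_le (by positivity) hlam hL hS hR hd hT⟩
  · intro d T lam L R hd hT hlam hR Ω mΩ μ _ ℱ w 𝒟 η xstar x hB hrun
    refine ⟨BiasOFUL.integrable_pseudoRegret hB hrun,
      (BiasOFUL.integral_pseudoRegret_le hd hT hlam hR hB hrun).trans (le_of_eq ?_)⟩
    -- With h = w the bias term √λ‖h − w‖ is zero.
    simp [BiasOFUL.itlBound, BiasOFUL.oracleBound]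
  · intro d T L R hd hT _ _
    exact BiasOFUL.tendsto_oracleBound _ L R hd hT
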